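/- Let $G$ be a group. A \emph{character} of $G$ is a function $\psi\colon G\to\mathbb C$ of positive type, constant on conjugacy classes, with $\psi(1)=1$. Let $\ell^\psi(G)$ be the completion of $\mathbb C[G]$ with respect to the semidefinite inner product determined by $\langle g,h\rangle_\psi=\psi(h^{-1}g)$, a Hilbert space with commuting left and right $G$-actions. For a finite set $S$ and a closed left $G$-invariant subspace $V\le \ell^\psi(G)^S$ with orthogonal projection $P$ put $\dim_\psi V=\sum_{s\in S}\langle Pe_s,e_s\rangle_\psi$, where $e_s$ is the element $1\in\ell^\psi(G)$ in the coordinate $s$. If $G$ is finitely generated, $b_1^\psi(G)$ denotes the $\psi$-dimension of the reduced first homology $\ker\partial_1/\overline{\operatorname{im}\partial_2}$ (identified with the orthogonal complement of $\operatorname{im}\partial_2$ in $\ker\partial_1$) of the complex \[\ell^\psi(G)\otimes_{\mathbb C[G]}F_2\xrightarrow{\ \partial_2\ }\ell^\psi(G)^S\xrightarrow{\ \partial_1\ }\ell^\psi(G),\] obtained from the initial segment $F_2\to\mathbb C[G]^S\to\mathbb C[G]\to\mathbb C$ of a free resolution of $\mathbb C$ by left $\mathbb C[G]$-modules, where $S$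 is a finite generating set of $G$ and $\mathbb C[G]^S\to\mathbb C[G]$ maps the basis element $e_s$ to $s-1$. For an arbitrary group $G$ put \[\bar b_1^\psi(G)=\liminf_{K\le G}\, b_1^{\psi|_K}(K)\in[0,\infty],\] the limit inferior over the directed system of all finitely generated subgroups $K\le G$. For a subgroup $H\le G$ write $\bar b_1^\psi(H)=\bar b_1^{\psi|_H}(H)$. A subgroup $K\le G$ is \emph{$\psi$-regular} if $\psi(k)=0$ for all $k\in K\setminus\{1\}$. A subgroup $H\le G$ is \emph{q-$\psi$-normal} in $G$ if there is a set $A\subseteq G$ such that $G=\langle H\cup A\rangle$ and $H\cap aHa^{-1}$ contains an infinite $\psi$-regular subgroup for every $a\in A$. A subgroup $H\le G$ is \emph{weakly q-$\psi$-normal} if there are an ordinal $\alpha$ and an increasing chain of subgroups $(H_\beta)_{\beta\le\alpha}$ with $H_0=H$ and $H_\alpha=G$ such that $\bigcup_{\beta<\gamma}H_\beta$ is q-$\psi$-normal in $H_\gamma$ (with respect to $\psi|_{H_\gamma}$) for all $0<\gamma\le\alpha$. \textbf{Corollary.} Let $G$ be a group and let $\psi$ be a character of $G$. If $H\le G$ is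 a weakly q-$\psi$-normal subgroup, then \[\bar b_1^\psi(G)\le\bar b_1^\psi(H).\] -/

import Mathlib

open scoped ComplexOrder

universe u v

noncomputable section

namespace PsiBetti

/-! ### Characters -/

/-- A character of a group `G`: a function `ψ : G → ℂ` of positive type, constant on conjugacy
classes, with `ψ 1 = 1`. Positive type means that the kernel `(h, g) ↦ ψ (h⁻¹ g)` is positive
semidefinite, i.e. `∑ conj (x h) * ψ (h⁻¹ g) * x g ≥ 0` for all finitely supported `x : G → ℂ`. -/
structure GroupCharacter (G : Type u) [Group G] where
  toFun : G → ℂ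
  posType : (Matrix.of fun h g : G => toFun (h⁻¹ * g)).PosSemidef
  conj_eq : ∀ g h : G, toFun (h * g * h⁻¹) = toFun g
  map_one : toFun 1 = 1

variable {G : Type u} [Group G]

instance : CoeFun (GroupCharacter G) (fun _ => G → ℂ) := ⟨GroupCharacter.toFun⟩

/-- The restriction of a character to a subgroup. -/
def GroupCharacter.restrict (ψ : GroupCharacter G) (H : Subgroup G) : GroupCharacter H where
  toFun h := ψ (h : G)
  posType := ψ.posType.submatrix (fun h : H => (h : G))
  conj_eq g h := ψ.conj_eq (g : G) (h : G)
  map_one := ψ.map_one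

/-- `K` is `ψ`-regular if `ψ` vanishes on `K ∖ {1}`. -/
def IsRegular (ψ : GroupCharacter G) (K : Subgroup G) : Prop :=
  ∀ k ∈ K, k ≠ 1 → ψ k = 0

/-! ### The tracial Hilbert bimodule `ℓ^ψ(G)` -/

set_option linter.unusedVariables false in
/-- The vector space underlying the group ring `ℂ[G]`, to be equipped with the semidefinite inner
product determined by `ψ`. -/
def PreEll (ψ : GroupCharacter G) : Type u := G →₀ ℂ

instance (ψ : GroupCharacter G) : AddCommGroup (PreEll ψ) := inferInstanceAs (AddCommGroup (G →₀ ℂ))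

instance (ψ : GroupCharacter G) : Module ℂ (PreEll ψ) := inferInstanceAs (Module ℂ (G →₀ ℂ))

/-- The identity map from finitely supported functions to `PreEll ψ`. -/
def toPreEll (ψ : GroupCharacter G) : (G →₀ ℂ) ≃ₗ[ℂ] PreEll ψ := LinearEquiv.refl ℂ _

/-- The semidefinite sesquilinear form on `ℂ[G]` with `⟪g, h⟫ = ψ (g⁻¹ h)` for `g h : G`. (Inner
products are conjugate-linear in the first argument here; in the convention that is linear in
the first argument this reads `⟨g, h⟩ = ψ (h⁻¹ g)`.) -/
def form (ψ : GroupCharacter G) (x y : G →₀ ℂ) : ℂ :=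
  x.sum fun g a => y.sum fun h b => star a * ψ (g⁻¹ * h) * b

/-- The semidefinite inner product on `ℂ[G]` given by `form`. -/
abbrev preInnerCore (ψ : GroupCharacter G) : PreInnerProductSpace.Core ℂ (PreEll ψ) where
  inner x y := form ψ ((toPreEll ψ).symm x) ((toPreEll ψ).symm y)
  conj_inner_symm x y := by
    have hsymm : ∀ g h : G, star (ψ (h⁻¹ * g)) = ψ (g⁻¹ * h) := fun g h => by
      simpa using ψ.posType.1.apply g h
    simp only [form, Finsupp.sum, ← Complex.star_def, star_sum, star_mul', star_star, hsymm]
    rw [Finset.sum_comm]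
    exact Finset.sum_congr rfl fun g _ => Finset.sum_congr rfl fun h _ => by ring
  re_inner_nonneg x := (RCLike.nonneg_iff.mp (ψ.posType.2 ((toPreEll ψ).symm x))).1
  add_left x y z := by
    simp only [form, map_add]
    refine Finsupp.sum_add_index' (fun g => ?_) (fun g a b => ?_)
    · simp
    · simp only [star_add, add_mul, Finsupp.sum, Finset.sum_add_distrib]
  smul_left x y r := by
    simp only [form, map_smul]
    refine (Finsupp.sum_smul_index' (fun g => ?_)).trans ?_
    · simp
    · simp only [Finsupp.sum, Finset.mul_sum, smul_eq_mul, star_mul', ← Complex.star_def, mul_assoc]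

instance (ψ : GroupCharacter G) : SeminormedAddCommGroup (PreEll ψ) :=
  @InnerProductSpace.Core.toSeminormedAddCommGroup ℂ (PreEll ψ) _ _ _ (preInnerCore ψ)

instance (ψ : GroupCharacter G) : InnerProductSpace ℂ (PreEll ψ) :=
  InnerProductSpace.ofCore (preInnerCore ψ)

/-- The Hilbert space `ℓ^ψ(G)`: the (Hausdorff) completion of `ℂ[G]`. -/
abbrev Ell (ψ : GroupCharacter G) : Type u := UniformSpace.Completion (PreEll ψ)

/-- The image in `ℓ^ψ(G)` of a group element. -/
def delta (ψ : GroupCharacter G) (g : G) : Ell ψ :=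
  (toPreEll ψ (Finsupp.single g 1) : PreEll ψ)

/-- The form is invariant under right translations because `ψ` is a class function. -/
theorem form_right (ψ : GroupCharacter G) (g : G) (x y : G →₀ ℂ) :
    form ψ (x.mapDomain (· * g)) (y.mapDomain (· * g)) = form ψ x y := by
  have hconj : ∀ a b : G, ψ ((a * g)⁻¹ * (b * g)) = ψ (a⁻¹ * b) := fun a b => by
    rw [← ψ.conj_eq (a⁻¹ * b) g⁻¹]
    congr 1
    group
  unfold form
  rw [Finsupp.sum_mapDomain_index (fun a => by simp)
    (fun a r s => by simp only [star_add, add_mul, Finsupp.sum, Finset.sum_add_distrib])]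
  refine Finsupp.sum_congr fun a _ => ?_
  rw [Finsupp.sum_mapDomain_index (fun b => by simp) (fun b r s => by rw [mul_add])]
  simp only [hconj]

/-- Right translation `h ↦ h g` on `ℂ[G]`, an isometry. -/
def preRight (ψ : GroupCharacter G) (g : G) : PreEll ψ →ₗᵢ[ℂ] PreEll ψ where
  toLinearMap := (toPreEll ψ).toLinearMap ∘ₗ
    Finsupp.lmapDomain ℂ ℂ (fun h : G => h * g) ∘ₗ (toPreEll ψ).symm.toLinearMap
  norm_map' x := by
    rw [@norm_eq_sqrt_re_inner ℂ (PreEll ψ), @norm_eq_sqrt_re_inner ℂ (PreEll ψ)]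
    exact congrArg (fun c : ℂ => √(RCLike.re c))
      (form_right ψ g ((toPreEll ψ).symm x) ((toPreEll ψ).symm x))

/-- The right action of `g` on `ℓ^ψ(G)`: the continuous extension of `h ↦ h g`. -/
def right (ψ : GroupCharacter G) (g : G) : Ell ψ →L[ℂ] Ell ψ :=
  (preRight ψ g).toContinuousLinearMap.completion

/-- The right action `x ↦ x w` on `ℓ^ψ(G)` of an element `w` of the group ring `ℂ[G]`. -/
def rightAlg (ψ : GroupCharacter G) (w : MonoidAlgebra ℂ G) : Ell ψ →L[ℂ] Ell ψ :=
  w.coeff.sum fun g c => c • right ψ g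

/-! ### The dimension of subspaces of `ℓ^ψ(G)^S` -/

/-- The Hilbert space `ℓ^ψ(G)^S`. -/
abbrev EllPow (ψ : GroupCharacter G) (S : Finset G) : Type u := PiLp 2 (fun _ : S => Ell ψ)

open Classical in
/-- The vector `1` in the coordinate `s` of `ℓ^ψ(G)^S`. -/
def basisVec (ψ : GroupCharacter G) (S : Finset G) (s : S) : EllPow ψ S :=
  PiLp.single 2 s (delta ψ 1)

/-- The von Neumann dimension `∑ s, ⟪P e_s, e_s⟫` of a `G`-invariant subspace `V` of `ℓ^ψ(G)^S`,
where `P` is the orthogonal projection onto the closure of `V`. -/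
def vnDim (ψ : GroupCharacter G) (S : Finset G) (V : Submodule ℂ (EllPow ψ S)) : ℝ :=
  ∑ s : S, RCLike.re
    (inner ℂ (basisVec ψ S s) (V.topologicalClosure.starProjection (basisVec ψ S s)))

/-! ### The complex and its reduced first homology

For a finite generating set `S` of `G`, let `Z = ker (ℂ[G]^S → ℂ[G])`, where the basis element
`e_s` goes to `s - 1` (this is the space of finite cycles in the Cayley graph). Then
`ℂ[G]^(Z) → ℂ[G]^S → ℂ[G] → ℂ` is the initial segment of a free resolution of `ℂ` by left
`ℂ[G]`-modules. Applying `ℓ^ψ(G) ⊗ -` gives `ℓ^ψ(G)^(Z) → ℓ^ψ(G)^S → ℓ^ψ(G)`. -/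

/-- The boundary map `ℂ[G]^S → ℂ[G]`, `e_s ↦ s - 1`. -/
def algBoundary (S : Finset G) : (S → MonoidAlgebra ℂ G) →ₗ[ℂ] MonoidAlgebra ℂ G :=
  ∑ s : S, (LinearMap.mulRight ℂ (MonoidAlgebra.of ℂ G (s : G) - 1)) ∘ₗ LinearMap.proj s

/-- The space `Z` of finite cycles. -/
def algCycles (S : Finset G) : Submodule ℂ (S → MonoidAlgebra ℂ G) :=
  LinearMap.ker (algBoundary S)

/-- `∂₁ : ℓ^ψ(G)^S → ℓ^ψ(G)`, `(x_s) ↦ ∑ x_s (s - 1)`. -/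
def boundaryOne (ψ : GroupCharacter G) (S : Finset G) : EllPow ψ S →L[ℂ] Ell ψ :=
  ∑ s : S, (right ψ (s : G) - ContinuousLinearMap.id ℂ (Ell ψ)) ∘L
    PiLp.proj (𝕜 := ℂ) 2 (fun _ : S => Ell ψ) s

/-- `∂₂ : ℓ^ψ(G)^(Z) → ℓ^ψ(G)^S`, which maps `x` in the coordinate `z` to `(x z_s)_s`. -/
def boundaryTwo (ψ : GroupCharacter G) (S : Finset G) :
    (algCycles S →₀ Ell ψ) →ₗ[ℂ] EllPow ψ S :=
  Finsupp.lsum ℂ fun z : algCycles S =>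
    (WithLp.linearEquiv 2 ℂ (S → Ell ψ)).symm.toLinearMap ∘ₗ
      LinearMap.pi fun s : S => (rightAlg ψ (z.1 s) : Ell ψ →ₗ[ℂ] Ell ψ)

/-- The reduced first homology `ker ∂₁ / closure (im ∂₂)`, realised as the orthogonal complement
of `im ∂₂` in `ker ∂₁`. -/
def reducedHomologyOne (ψ : GroupCharacter G) (S : Finset G) : Submodule ℂ (EllPow ψ S) :=
  LinearMap.ker (boundaryOne ψ S : EllPow ψ S →ₗ[ℂ] Ell ψ) ⊓ (LinearMap.range (boundaryTwo ψ S))ᗮ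

/-- The first `ψ`-Betti number `b₁^ψ(G)` of a finitely generated group, computed from some finite
generating set (the value does not depend on which one, by homotopy invariance). -/
def bettiOne (ψ : GroupCharacter G) (hG : Group.FG G) : ℝ :=
  vnDim ψ (Classical.choose hG.out) (reducedHomologyOne ψ (Classical.choose hG.out))

/-- `liminf` of `b₁^ψ(K)` over the directed system of finitely generated subgroups `K ≤ G`;
a value in the extended reals, possibly `∞`. -/
def bettiOneBar (ψ : GroupCharacter G) : EReal :=
  Filter.liminf
    (fun K : {K : Subgroup G // K.FG} =>
      ((bettiOne (ψ.restrict K.1) ((Group.fg_iff_subgroup_fg K.1).2 K.2) : ℝ) : EReal))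
    Filter.atTop

/-! ### (Weak) q-`ψ`-normality -/

/-- For subgroups `K ≤ L` of `G`: `K` is q-`ψ`-normal in `L`. (Then `A ⊆ L`, and regularity of
subgroups of `L` with respect to `ψ` and to the restriction of `ψ` to `L` are the same.) -/
def IsQNormalIn (ψ : GroupCharacter G) (K L : Subgroup G) : Prop :=
  ∃ A : Set G, L = Subgroup.closure ((K : Set G) ∪ A) ∧
    ∀ a ∈ A, ∃ R : Subgroup G, R ≤ K ⊓ K.map (MulAut.conj a).toMonoidHom ∧
      Infinite R ∧ IsRegular ψ R

/-- `H` is weakly q-`ψ`-normal in `G`: there are an ordinal `α` and an increasing chain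
`(C β)_{β ≤ α}` of subgroups from `C 0 = H` to `C α = G` such that, for `0 < γ ≤ α`, the union
of the `C β` with `β < γ` is q-`ψ`-normal in `C γ`. (The union of this nonempty chain is its
supremum in the lattice of subgroups.) -/
def IsWeaklyQNormal (ψ : GroupCharacter G) (H : Subgroup G) : Prop :=
  ∃ (α : Ordinal.{v}) (C : Ordinal.{v} → Subgroup G),
    C 0 = H ∧ C α = ⊤ ∧ (∀ β γ, β ≤ γ → γ ≤ α → C β ≤ C γ) ∧
    ∀ γ, 0 < γ → γ ≤ α → IsQNormalIn ψ (⨆ β : Set.Iio γ, C β) (C γ)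

end PsiBetti

end

/-! Write b₁ as dim ker ∂₁ minus the dimension of the closure of the finite cycles
(`vnDim_reducedHomologyOne`). Suppose a generating family is enlarged by an element a, and some w in
ℂ[G] is close to 1 in ℓ^ψ(G) with w(a - 1) a boundary of the old family. Then the new coordinate
adds at most 1 to the dimension of the kernel, while the cycle with entry w there adds almost 1 to
that of the cycles, so b₁ hardly grows (`famBetti_le_add`). If K contains n elements r, pairwise
orthogonal in ℓ^ψ, whose conjugates a⁻¹ra also lie in K, then w = 1 minus the average of the r works
with error 1/n (`bettiOne_le_add`). An infinite ψ-regular subgroup of H ∩ aHa⁻¹ supplies such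
elements for every n.

Counting dimensions coordinate by coordinate needs additivity (`dimAt_eq_add`), which follows from
dim ker T = dim ker T† for equivariant contractions. The mean ergodic theorem expresses these
dimensions through the traces of powers of 1 - T†T and 1 - TT†, and those agree because the trace is
tracial. Additivity also gives independence of the generating set (`famBetti_le_add` with error 0
and `famBetti_inl_le`).

For arbitrary groups, `BettiBound` restates the bound on the liminf for subgroups of a fixed ambient
group. It passes to unions of chains and along q-ψ-normal inclusions, so transfinite induction
carries it from H to G. -/

noncomputable section

namespace PsiBetti

/-! ### Projections and traces in Hilbert spaces -/

section Hilbert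

open ContinuousLinearMap InnerProductSpace Filter Topology

variable {X Y : Type*} [NormedAddCommGroup X] [InnerProductSpace ℂ X]
  [NormedAddCommGroup Y] [InnerProductSpace ℂ Y]

/-- A contraction that maps `V` into `W` and preserves the norm of `x` does not decrease the norm
of the projection of `x`. -/
theorem norm_starProjection_le_of_contraction (T : X →L[ℂ] Y) (hT : ∀ x, ‖T x‖ ≤ ‖x‖)
    (V : Submodule ℂ X) (W : Submodule ℂ Y) [V.HasOrthogonalProjection]
    [W.HasOrthogonalProjection] (h : ∀ v ∈ V, T v ∈ W) (x : X) (hx : ‖T x‖ = ‖x‖) :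
    ‖V.starProjection x‖ ≤ ‖W.starProjection (T x)‖ := by
  have h1 := V.norm_sq_eq_add_norm_sq_starProjection x
  have h2 := W.norm_sq_eq_add_norm_sq_starProjection (T x)
  rw [Submodule.starProjection_orthogonal_val] at h1 h2
  -- Compare distances: T(P_V x) lies in W, and T does not increase its distance to T x. Pythagoras
  -- turns this into the bound on projections.
  have h3 : ‖T x - W.starProjection (T x)‖ ≤ ‖x - V.starProjection x‖ := by
    rw [W.starProjection_minimal]
    refine (ciInf_le ⟨0, ?_⟩ ⟨T (V.starProjection x), h _ (V.starProjection_apply_mem x)⟩).trans ?_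
    · rintro _ ⟨y, rfl⟩
      positivity
    · simpa using hT (x - V.starProjection x)
  have h4 : ‖T x - W.starProjection (T x)‖ ^ 2 ≤ ‖x - V.starProjection x‖ ^ 2 := by gcongr
  rw [hx] at h2
  exact le_of_sq_le_sq (by linarith) (norm_nonneg _)

theorem one_sub_le_norm_starProjection_sq (W : Submodule ℂ X) [W.HasOrthogonalProjection] (x w : X)
    (hw : w ∈ W) : ‖x‖ ^ 2 - ‖x - w‖ ^ 2 ≤ ‖W.starProjection x‖ ^ 2 := by
  have h2 := W.norm_sq_eq_add_norm_sq_starProjection x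
  rw [Submodule.starProjection_orthogonal_val] at h2
  have h3 : ‖x - W.starProjection x‖ ≤ ‖x - w‖ := by
    rw [W.starProjection_minimal]
    refine ciInf_le ⟨0, ?_⟩ (⟨w, hw⟩ : W)
    rintro _ ⟨y, rfl⟩
    positivity
  have h4 : ‖x - W.starProjection x‖ ^ 2 ≤ ‖x - w‖ ^ 2 := by gcongr
  linarith

variable {ι : Type*} [Fintype ι]

/-- The sum of the diagonal matrix coefficients of `A` at a finite family of vectors. -/
def traceAt (e : ι → X) (A : X →L[ℂ] X) : ℂ := ∑ i, inner ℂ (e i) (A (e i))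

theorem traceAt_starProjection (e : ι → X) (V : Submodule ℂ X) [V.HasOrthogonalProjection] :
    traceAt e V.starProjection = ((∑ i, ‖V.starProjection (e i)‖ ^ 2 : ℝ) : ℂ) := by
  rw [traceAt, Complex.ofReal_sum]
  refine Finset.sum_congr rfl fun i _ => ?_
  have h : V.starProjection (e i) = V.starProjection (V.starProjection (e i)) :=
    (Submodule.starProjection_eq_self_iff.2 (V.starProjection_apply_mem _)).symm
  conv_lhs => rw [h]
  rw [← Submodule.inner_starProjection_left_eq_right, inner_self_eq_norm_sq_to_K]
  simp

variable [CompleteSpace X]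

/-- Expanding gives ‖x - T†Tx‖² = ‖x‖² - 2‖Tx‖² + ‖T†Tx‖², and the last term is at most ‖Tx‖². -/
theorem norm_one_sub_adjoint_mul_self_le (T : X →L[ℂ] X) (hT : ‖T‖ ≤ 1) :
    ‖1 - adjoint T * T‖ ≤ 1 := by
  refine ContinuousLinearMap.opNorm_le_bound _ zero_le_one fun x => ?_
  rw [one_mul]
  refine le_of_sq_le_sq ?_ (norm_nonneg _)
  have h1 : RCLike.re (inner ℂ x ((adjoint T * T) x)) = ‖T x‖ ^ 2 := by
    rw [mul_apply_eq_comp, adjoint_inner_right, inner_self_eq_norm_sq]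
  have h2 : ‖(adjoint T * T) x‖ ≤ ‖T x‖ := by
    rw [mul_apply_eq_comp]
    refine ((adjoint T).le_opNorm _).trans ?_
    rw [LinearIsometryEquiv.norm_map]
    exact mul_le_of_le_one_left (norm_nonneg _) hT
  have h3 : ‖(adjoint T * T) x‖ ^ 2 ≤ ‖T x‖ ^ 2 := by gcongr
  have h4 := @norm_sub_sq ℂ X _ _ _ x ((adjoint T * T) x)
  rw [h1] at h4
  rw [sub_apply, one_apply_eq_self, h4]
  nlinarith [sq_nonneg ‖T x‖]

/-- Von Neumann's mean ergodic theorem for the contraction 1 - T†T, whose fixed vectors form ker T†T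
= ker T. It replaces polar decomposition and functional calculus. -/
theorem tendsto_traceAt_ker (e : ι → X) (T : X →L[ℂ] X) (hT : ‖T‖ ≤ 1) :
    Tendsto (fun N : ℕ => (N : ℂ)⁻¹ * ∑ n ∈ Finset.range N, traceAt e ((1 - adjoint T * T) ^ n))
      atTop (𝓝 (traceAt e T.ker.starProjection)) := by
  set f : X →L[ℂ] X := 1 - adjoint T * T with hf
  have hfix : f.eqLocus (1 : X →L[ℂ] X) = T.ker := by
    rw [← T.ker_adjoint_comp_self]
    ext x
    simp [hf, LinearMap.mem_eqLocus]
  have key (i : ι) : Tendsto (fun N : ℕ => inner ℂ (e i) (birkhoffAverage ℂ f _root_.id N (e i)))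
      atTop (𝓝 (inner ℂ (e i) (T.ker.starProjection (e i)))) := by
    have := f.tendsto_birkhoffAverage_orthogonalProjection
      (norm_one_sub_adjoint_mul_self_le T hT) (e i)
    have h2 : ((f.eqLocus (1 : X →L[ℂ] X)).orthogonalProjectionOnto (e i) : X) =
        T.ker.starProjection (e i) := by
      rw [← Submodule.starProjection_apply]
      simp only [hfix]
    rw [← h2]
    exact tendsto_const_nhds.inner this
  refine (tendsto_finsetSum Finset.univ fun i _ => key i).congr fun N => ?_
  simp only [birkhoffAverage, birkhoffSum, inner_smul_right, inner_sum, traceAt, Finset.mul_sum]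
  rw [Finset.sum_comm]
  refine Finset.sum_congr rfl fun n _ => Finset.sum_congr rfl fun i _ => ?_
  simp

/-- If `1 - T† T` and `1 - T T†` have powers of equal trace, then the kernels of `T` and `T†` have
equal dimension. -/
theorem traceAt_ker_eq (e : ι → X) (T : X →L[ℂ] X) (hT : ‖T‖ ≤ 1)
    (h : ∀ n, traceAt e ((1 - adjoint T * T) ^ n) = traceAt e ((1 - T * adjoint T) ^ n)) :
    traceAt e T.ker.starProjection = traceAt e (adjoint T).ker.starProjection := by
  have h1 := tendsto_traceAt_ker e T hT
  have h2 := tendsto_traceAt_ker e (adjoint T) (by rwa [LinearIsometryEquiv.norm_map])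
  rw [adjoint_adjoint] at h2
  simp only [h] at h1
  exact tendsto_nhds_unique h1 h2

/-- The dimension of the closure of `V`, relative to a finite family of vectors. -/
def dimAt (e : ι → X) (V : Submodule ℂ X) : ℝ :=
  ∑ i, ‖V.topologicalClosure.starProjection (e i)‖ ^ 2

theorem dimAt_eq_of_isClosed (e : ι → X) (V : Submodule ℂ X) [V.HasOrthogonalProjection]
    (hV : IsClosed (V : Set X)) : dimAt e V = ∑ i, ‖V.starProjection (e i)‖ ^ 2 := by
  unfold dimAt
  have := hV.submodule_topologicalClosure_eq
  congr! 3
  simp only [this]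

theorem dimAt_topologicalClosure (e : ι → X) (V : Submodule ℂ X) :
    dimAt e V.topologicalClosure = dimAt e V :=
  dimAt_eq_of_isClosed e _ V.isClosed_topologicalClosure

theorem dimAt_add_orthogonal (e : ι → X) (V : Submodule ℂ X) :
    dimAt e V + dimAt e Vᗮ = ∑ i, ‖e i‖ ^ 2 := by
  rw [dimAt_eq_of_isClosed e Vᗮ V.isClosed_orthogonal, dimAt, ← Finset.sum_add_distrib]
  refine Finset.sum_congr rfl fun i _ => ?_
  rw [V.topologicalClosure.norm_sq_eq_add_norm_sq_starProjection (e i)]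
  simp only [Submodule.orthogonal_closure]

theorem norm_starProjection_closure_le [CompleteSpace Y] (T : X →L[ℂ] Y) (hT : ∀ x, ‖T x‖ ≤ ‖x‖)
    (V : Submodule ℂ X) (W : Submodule ℂ Y) (h : ∀ v ∈ V, T v ∈ W.topologicalClosure) (x : X)
    (hx : ‖T x‖ = ‖x‖) :
    ‖V.topologicalClosure.starProjection x‖ ≤ ‖W.topologicalClosure.starProjection (T x)‖ := by
  refine norm_starProjection_le_of_contraction T hT _ _ (fun v hv => ?_) x hx
  have hle : V.topologicalClosure ≤ W.topologicalClosure.comap (T : X →ₗ[ℂ] Y) :=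
    V.topologicalClosure_minimal h (W.isClosed_topologicalClosure.preimage T.continuous)
  exact hle hv

/-- The projection to U ⊓ Rᗮ is the difference of the projections to U and to the closure of R, and
the two pieces are orthogonal. -/
theorem dimAt_inf_orthogonal (e : ι → X) (U R : Submodule ℂ X) (hU : IsClosed (U : Set X))
    (hR : R ≤ U) : dimAt e (U ⊓ Rᗮ) = dimAt e U - dimAt e R := by
  have hc : IsClosed ((U ⊓ Rᗮ : Submodule ℂ X) : Set X) := hU.inter R.isClosed_orthogonal
  have : CompleteSpace U := hU.completeSpace_coe
  have : CompleteSpace (U ⊓ Rᗮ : Submodule ℂ X) := hc.completeSpace_coe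
  have hR' : R.topologicalClosure ≤ U := R.topologicalClosure_minimal hR hU
  rw [dimAt_eq_of_isClosed e _ hU, dimAt_eq_of_isClosed e _ hc, dimAt, ← Finset.sum_sub_distrib]
  refine Finset.sum_congr rfl fun i _ => ?_
  have h1 : (U ⊓ Rᗮ).starProjection (e i) =
      U.starProjection (e i) - R.topologicalClosure.starProjection (e i) := by
    refine Submodule.eq_starProjection_of_mem_of_inner_eq_zero ⟨?_, ?_⟩ fun w hw => ?_
    · exact U.sub_mem (U.starProjection_apply_mem _) (hR' (Submodule.starProjection_apply_mem _ _))
    · rw [← Submodule.orthogonal_closure, SetLike.mem_coe, Submodule.mem_orthogonal']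
      intro w hw
      have h1 := U.starProjection_inner_eq_zero (e i) w (hR' hw)
      have h2 := R.topologicalClosure.starProjection_inner_eq_zero (e i) w hw
      rw [← sub_sub_sub_cancel_left _ _ (e i), inner_sub_left, h1, h2, sub_zero]
    · have h1 := U.starProjection_inner_eq_zero (e i) w hw.1
      have h2 : inner ℂ (R.topologicalClosure.starProjection (e i)) w = 0 := by
        have := hw.2
        rw [SetLike.mem_coe, ← Submodule.orthogonal_closure] at this
        exact this _ (Submodule.starProjection_apply_mem _ _)
      rw [sub_sub_eq_add_sub, add_sub_right_comm, inner_add_left, h1, h2, add_zero]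
  have h2 : inner ℂ ((U ⊓ Rᗮ).starProjection (e i))
      (R.topologicalClosure.starProjection (e i)) = 0 := by
    have h := ((U ⊓ Rᗮ).starProjection_apply_mem (e i)).2
    rw [h1, SetLike.mem_coe, ← Submodule.orthogonal_closure] at h
    rw [h1]
    exact (Submodule.mem_orthogonal' _ _).1 h _ (Submodule.starProjection_apply_mem _ _)
  have h3 : U.starProjection (e i) =
      (U ⊓ Rᗮ).starProjection (e i) + R.topologicalClosure.starProjection (e i) := by
    rw [h1, sub_add_cancel]
  rw [h3, sq ‖_ + _‖, norm_add_sq_eq_norm_sq_add_norm_sq_of_inner_eq_zero _ _ h2]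
  ring

end Hilbert

/-! ### Maps between the spaces `ℓ^ψ(G)` -/

section Maps

open UniformSpace

variable {G : Type u} [Group G] {K : Type*} [Group K]

theorem form_single (ψ : GroupCharacter G) (g h : G) (a b : ℂ) :
    form ψ (Finsupp.single g a) (Finsupp.single h b) = star a * ψ (g⁻¹ * h) * b := by
  simp [form]

theorem inner_toPreEll (ψ : GroupCharacter G) (x y : G →₀ ℂ) :
    inner ℂ (toPreEll ψ x) (toPreEll ψ y) = form ψ x y := rfl

theorem form_mapDomain (φ : GroupCharacter K) (ψ : GroupCharacter G) (u : K → G)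
    (hu : ∀ a b, ψ ((u a)⁻¹ * u b) = φ (a⁻¹ * b)) (x y : K →₀ ℂ) :
    form ψ (x.mapDomain u) (y.mapDomain u) = form φ x y := by
  unfold form
  rw [Finsupp.sum_mapDomain_index (fun a => by simp)
    (fun a r s => by simp only [star_add, add_mul, Finsupp.sum, Finset.sum_add_distrib])]
  refine Finsupp.sum_congr fun a _ => ?_
  rw [Finsupp.sum_mapDomain_index (fun b => by simp) (fun b r s => by rw [mul_add])]
  simp only [hu]

/-- The isometry of pre-Hilbert spaces induced by a map that preserves inner products of group
elements. -/
def preMap (φ : GroupCharacter K) (ψ : GroupCharacter G) (u : K → G)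
    (hu : ∀ a b, ψ ((u a)⁻¹ * u b) = φ (a⁻¹ * b)) : PreEll φ →ₗᵢ[ℂ] PreEll ψ where
  toLinearMap := (toPreEll ψ).toLinearMap ∘ₗ
    Finsupp.lmapDomain ℂ ℂ u ∘ₗ (toPreEll φ).symm.toLinearMap
  norm_map' x := by
    rw [@norm_eq_sqrt_re_inner ℂ (PreEll ψ), @norm_eq_sqrt_re_inner ℂ (PreEll φ)]
    exact congrArg (fun c : ℂ => √(RCLike.re c))
      (form_mapDomain φ ψ u hu ((toPreEll φ).symm x) ((toPreEll φ).symm x))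

/-- The isometry `ℓ^φ(K) → ℓ^ψ(G)` induced by a map `K → G` that preserves inner products of group
elements. -/
def ellMap (φ : GroupCharacter K) (ψ : GroupCharacter G) (u : K → G)
    (hu : ∀ a b, ψ ((u a)⁻¹ * u b) = φ (a⁻¹ * b)) : Ell φ →L[ℂ] Ell ψ :=
  (preMap φ ψ u hu).toContinuousLinearMap.completion

theorem ellMap_coe (φ : GroupCharacter K) (ψ : GroupCharacter G) (u : K → G)
    (hu : ∀ a b, ψ ((u a)⁻¹ * u b) = φ (a⁻¹ * b)) (x : K →₀ ℂ) :
    ellMap φ ψ u hu (toPreEll φ x : PreEll φ) = (toPreEll ψ (x.mapDomain u) : PreEll ψ) :=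
  ContinuousLinearMap.completion_apply_coe _ _

theorem ellMap_delta (φ : GroupCharacter K) (ψ : GroupCharacter G) (u : K → G)
    (hu : ∀ a b, ψ ((u a)⁻¹ * u b) = φ (a⁻¹ * b)) (g : K) :
    ellMap φ ψ u hu (delta φ g) = delta ψ (u g) := by
  rw [delta, ellMap_coe, Finsupp.mapDomain_single, delta]

theorem inner_ellMap (φ : GroupCharacter K) (ψ : GroupCharacter G) (u : K → G)
    (hu : ∀ a b, ψ ((u a)⁻¹ * u b) = φ (a⁻¹ * b)) (x y : Ell φ) :
    inner ℂ (ellMap φ ψ u hu x) (ellMap φ ψ u hu y) = inner ℂ x y := by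
  refine Completion.induction_on₂ x y (isClosed_eq (by fun_prop) (by fun_prop)) fun x y => ?_
  have hx := ellMap_coe φ ψ u hu ((toPreEll φ).symm x)
  have hy := ellMap_coe φ ψ u hu ((toPreEll φ).symm y)
  rw [LinearEquiv.apply_symm_apply] at hx hy
  rw [hx, hy, Completion.inner_coe, Completion.inner_coe, inner_toPreEll, form_mapDomain φ ψ u hu]
  rfl

theorem norm_ellMap (φ : GroupCharacter K) (ψ : GroupCharacter G) (u : K → G)
    (hu : ∀ a b, ψ ((u a)⁻¹ * u b) = φ (a⁻¹ * b)) (x : Ell φ) :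
    ‖ellMap φ ψ u hu x‖ = ‖x‖ := by
  rw [@norm_eq_sqrt_re_inner ℂ, @norm_eq_sqrt_re_inner ℂ, inner_ellMap]

theorem inner_delta (ψ : GroupCharacter G) (g h : G) :
    inner ℂ (delta ψ g) (delta ψ h) = ψ (g⁻¹ * h) := by
  rw [delta, delta, Completion.inner_coe, inner_toPreEll, form_single]
  simp

/-- The linear map from the group ring to `ℓ^ψ(G)`. -/
def toEll (ψ : GroupCharacter G) : MonoidAlgebra ℂ G →ₗ[ℂ] Ell ψ where
  toFun w := (toPreEll ψ w.coeff : PreEll ψ)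
  map_add' x y := by
    rw [MonoidAlgebra.coeff_add, map_add, Completion.coe_add]
  map_smul' r x := by
    rw [MonoidAlgebra.coeff_smul, map_smul, Completion.coe_smul, RingHom.id_apply]

theorem toEll_apply (ψ : GroupCharacter G) (w : MonoidAlgebra ℂ G) :
    toEll ψ w = (toPreEll ψ w.coeff : PreEll ψ) := rfl

theorem toEll_single (ψ : GroupCharacter G) (g : G) (c : ℂ) :
    toEll ψ (MonoidAlgebra.single g c) = c • delta ψ g := by
  rw [← mul_one c, ← MonoidAlgebra.smul_single', map_smul, mul_one, toEll_apply, delta,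
    MonoidAlgebra.coeff_single]

theorem toEll_of (ψ : GroupCharacter G) (g : G) :
    toEll ψ (MonoidAlgebra.of ℂ G g) = delta ψ g := by
  rw [MonoidAlgebra.of_apply, toEll_single, one_smul]

theorem toEll_one (ψ : GroupCharacter G) : toEll ψ 1 = delta ψ 1 := by
  rw [MonoidAlgebra.one_def, toEll_single, one_smul]

theorem denseRange_toEll (ψ : GroupCharacter G) : DenseRange (toEll ψ) := by
  have h : Function.Surjective fun w : MonoidAlgebra ℂ G => toPreEll ψ w.coeff := fun x =>
    ⟨MonoidAlgebra.ofCoeff ((toPreEll ψ).symm x), by simp⟩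
  exact Completion.denseRange_coe.comp h.denseRange (Completion.continuous_coe _)

theorem ext_delta {Y : Type*} [NormedAddCommGroup Y] [NormedSpace ℂ Y] (ψ : GroupCharacter G)
    {A B : Ell ψ →L[ℂ] Y} (h : ∀ g, A (delta ψ g) = B (delta ψ g)) : A = B := by
  have h1 : (A : Ell ψ →ₗ[ℂ] Y) ∘ₗ toEll ψ = (B : Ell ψ →ₗ[ℂ] Y) ∘ₗ toEll ψ := by
    refine LinearMap.ext fun w => ?_
    induction w using MonoidAlgebra.induction_linear with
    | zero => simp
    | add x y hx hy => rw [map_add, map_add, hx, hy]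
    | single g c => simp [toEll_single, h]
  refine ContinuousLinearMap.coeFn_injective ?_
  exact (denseRange_toEll ψ).equalizer A.continuous B.continuous
    (funext fun w => LinearMap.congr_fun h1 w)

theorem eq_of_inner_delta (ψ : GroupCharacter G) {x y : Ell ψ}
    (h : ∀ g, inner ℂ (delta ψ g) x = inner ℂ (delta ψ g) y) : x = y := by
  have h1 : innerSL ℂ x = innerSL ℂ y := ext_delta ψ fun g => by
    rw [innerSL_apply_apply, innerSL_apply_apply, ← inner_conj_symm, h, inner_conj_symm]
  exact (innerSL_inj).1 h1

/-- Left translation by `g` on `ℓ^ψ(G)`. -/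
def left (ψ : GroupCharacter G) (g : G) : Ell ψ →L[ℂ] Ell ψ :=
  ellMap ψ ψ (fun h => g * h) fun a b => by group

theorem left_delta (ψ : GroupCharacter G) (g h : G) :
    left ψ g (delta ψ h) = delta ψ (g * h) := ellMap_delta ..

theorem right_delta (ψ : GroupCharacter G) (g h : G) :
    right ψ g (delta ψ h) = delta ψ (h * g) := by
  rw [right, delta, ContinuousLinearMap.completion_apply_coe, delta]
  congr 1
  exact Finsupp.mapDomain_single

theorem left_left (ψ : GroupCharacter G) (g h : G) (x : Ell ψ) :
    left ψ g (left ψ h x) = left ψ (g * h) x := by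
  refine DFunLike.congr_fun (?_ : left ψ g ∘L left ψ h = left ψ (g * h)) x
  exact ext_delta ψ fun k => by simp [left_delta, mul_assoc]

theorem left_one (ψ : GroupCharacter G) (x : Ell ψ) : left ψ 1 x = x := by
  refine DFunLike.congr_fun (?_ : left ψ 1 = ContinuousLinearMap.id ℂ _) x
  exact ext_delta ψ fun k => by simp [left_delta]

theorem left_right (ψ : GroupCharacter G) (g h : G) (x : Ell ψ) :
    left ψ g (right ψ h x) = right ψ h (left ψ g x) := by
  refine DFunLike.congr_fun (?_ : left ψ g ∘L right ψ h = right ψ h ∘L left ψ g) x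
  exact ext_delta ψ fun k => by simp [left_delta, right_delta, mul_assoc]

theorem inner_left (ψ : GroupCharacter G) (g : G) (x y : Ell ψ) :
    inner ℂ (left ψ g x) y = inner ℂ x (left ψ g⁻¹ y) := by
  have h := inner_ellMap ψ ψ (fun h => g * h) (fun a b => by group) x (left ψ g⁻¹ y)
  rw [← h]
  change _ = inner ℂ _ (left ψ g (left ψ g⁻¹ y))
  rw [left_left, mul_inv_cancel, left_one]
  rfl

/-- The antilinear map `g ↦ g⁻¹` on `ℂ[G]`. -/
def preStar (ψ : GroupCharacter G) : PreEll ψ →ₛₗ[starRingEnd ℂ] PreEll ψ where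
  toFun x := toPreEll ψ
    ((((toPreEll ψ).symm x).mapRange star (star_zero ℂ)).mapDomain fun g : G => g⁻¹)
  map_add' x y := by
    rw [map_add, Finsupp.mapRange_add (fun a b => star_add a b), Finsupp.mapDomain_add, map_add]
  map_smul' r x := by
    have h : ((toPreEll ψ).symm (r • x)).mapRange star (star_zero ℂ) =
        star r • ((toPreEll ψ).symm x).mapRange star (star_zero ℂ) := by
      ext g
      simp
    rw [h, Finsupp.mapDomain_smul, map_smul]
    rfl

theorem preStar_single (ψ : GroupCharacter G) (g : G) (a : ℂ) :
    preStar ψ (toPreEll ψ (Finsupp.single g a)) = toPreEll ψ (Finsupp.single g⁻¹ (star a)) := by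
  change toPreEll ψ (((Finsupp.single g a).mapRange star (star_zero ℂ)).mapDomain _) = _
  rw [Finsupp.mapRange_single, Finsupp.mapDomain_single]

/-- On group elements this is ψ(gh⁻¹) = ψ(h⁻¹g), which holds because ψ is a class function. The
trace property ultimately rests on it. -/
theorem inner_preStar (ψ : GroupCharacter G) (x y : PreEll ψ) :
    inner ℂ (preStar ψ x) (preStar ψ y) = inner ℂ y x := by
  obtain ⟨x, rfl⟩ := (toPreEll ψ).surjective x
  obtain ⟨y, rfl⟩ := (toPreEll ψ).surjective y
  induction x using Finsupp.induction_linear with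
  | zero => simp
  | add x x' hx hx' => simp only [map_add, inner_add_left, inner_add_right, hx, hx']
  | single g a =>
    induction y using Finsupp.induction_linear with
    | zero => simp
    | add y y' hy hy' => simp only [map_add, inner_add_left, inner_add_right, hy, hy']
    | single h b =>
      rw [preStar_single, preStar_single, inner_toPreEll, inner_toPreEll, form_single, form_single,
        star_star, inv_inv, ← ψ.conj_eq (g * h⁻¹) h⁻¹]
      have : h⁻¹ * (g * h⁻¹) * h⁻¹⁻¹ = h⁻¹ * g := by group
      rw [this]
      ring

/-- The antiunitary involution of `ℓ^ψ(G)` that maps `g` to `g⁻¹`. -/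
def ellStar (ψ : GroupCharacter G) : Ell ψ →SL[starRingEnd ℂ] Ell ψ :=
  ContinuousLinearMap.completion
    (LinearIsometry.toContinuousLinearMap
      { preStar ψ with
        norm_map' := fun x => by
          rw [@norm_eq_sqrt_re_inner ℂ (PreEll ψ), @norm_eq_sqrt_re_inner ℂ (PreEll ψ)]
          exact congrArg (fun c : ℂ => √(RCLike.re c)) (inner_preStar ψ x x) })

theorem ellStar_coe (ψ : GroupCharacter G) (x : PreEll ψ) :
    ellStar ψ (x : Ell ψ) = (preStar ψ x : PreEll ψ) :=
  ContinuousLinearMap.completion_apply_coe _ _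

theorem inner_ellStar (ψ : GroupCharacter G) (x y : Ell ψ) :
    inner ℂ (ellStar ψ x) (ellStar ψ y) = inner ℂ y x := by
  refine Completion.induction_on₂ x y (isClosed_eq (by fun_prop) (by fun_prop)) fun x y => ?_
  rw [ellStar_coe, ellStar_coe, Completion.inner_coe, Completion.inner_coe, inner_preStar]

theorem ellStar_delta (ψ : GroupCharacter G) (g : G) :
    ellStar ψ (delta ψ g) = delta ψ g⁻¹ := by
  rw [delta, ellStar_coe, preStar_single, star_one, delta]

theorem ellStar_ellStar (ψ : GroupCharacter G) (x : Ell ψ) : ellStar ψ (ellStar ψ x) = x := by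
  refine eq_of_inner_delta ψ fun g => ?_
  have h : delta ψ g = ellStar ψ (delta ψ g⁻¹) := by rw [ellStar_delta, inv_inv]
  rw [h, inner_ellStar, ← h, ← ellStar_delta, inner_ellStar]

end Maps

/-! ### Equivariant operators on `ℓ^ψ(G)^ι` -/

section Pow

open ContinuousLinearMap

variable {G : Type u} [Group G] (ψ : GroupCharacter G) (ι : Type*)

/-- The Hilbert space `ℓ^ψ(G)^ι`. -/
abbrev Pow : Type _ := PiLp 2 (fun _ : ι => Ell ψ)

variable {ψ ι}

/-- The continuous linear map to `ℓ^ψ(G)^ι` with given coordinates. -/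
def powLift {X : Type*} [NormedAddCommGroup X] [NormedSpace ℂ X] (A : ι → X →L[ℂ] Ell ψ) :
    X →L[ℂ] Pow ψ ι :=
  (PiLp.continuousLinearEquiv 2 ℂ (fun _ : ι => Ell ψ)).symm.toContinuousLinearMap ∘L
    ContinuousLinearMap.pi A

@[simp]
theorem powLift_apply {X : Type*} [NormedAddCommGroup X] [NormedSpace ℂ X]
    (A : ι → X →L[ℂ] Ell ψ) (x : X) (i : ι) : powLift A x i = A i x := rfl

open Classical in
/-- The vector `1` in the coordinate `i`. -/
def stdVec (ψ : GroupCharacter G) (i : ι) : Pow ψ ι := PiLp.single 2 i (delta ψ 1)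

theorem stdVec_apply_self (i : ι) : stdVec ψ i i = delta ψ 1 := by
  simp [stdVec]

theorem stdVec_apply_of_ne {i j : ι} (h : j ≠ i) : stdVec ψ i j = 0 := by
  simp [stdVec, h]

variable [Fintype ι]

/-- Left translation by `g` on `ℓ^ψ(G)^ι`. -/
def powLeft (ψ : GroupCharacter G) (ι : Type*) [Fintype ι] (g : G) : Pow ψ ι →L[ℂ] Pow ψ ι :=
  powLift fun i => left ψ g ∘L PiLp.proj 2 (fun _ : ι => Ell ψ) i

@[simp]
theorem powLeft_apply (g : G) (x : Pow ψ ι) (i : ι) : powLeft ψ ι g x i = left ψ g (x i) := rfl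

theorem inner_powLeft (g : G) (x y : Pow ψ ι) :
    inner ℂ (powLeft ψ ι g x) y = inner ℂ x (powLeft ψ ι g⁻¹ y) := by
  simp only [PiLp.inner_apply, powLeft_apply, inner_left]

theorem inner_powLeft_stdVec (g : G) (i : ι) (y : Pow ψ ι) :
    inner ℂ (powLeft ψ ι g (stdVec ψ i)) y = inner ℂ (delta ψ g) (y i) := by
  rw [PiLp.inner_apply, Finset.sum_eq_single i]
  · rw [powLeft_apply, stdVec_apply_self, left_delta, mul_one]
  · intro j _ hj
    rw [powLeft_apply, stdVec_apply_of_ne hj, map_zero, inner_zero_left]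
  · simp

theorem powLeft_one (x : Pow ψ ι) : powLeft ψ ι 1 x = x := by
  ext i
  rw [powLeft_apply, left_one]

theorem inner_stdVec (i : ι) (y : Pow ψ ι) :
    inner ℂ (stdVec ψ i) y = inner ℂ (delta ψ 1) (y i) := by
  rw [← inner_powLeft_stdVec, powLeft_one]

theorem norm_stdVec (i : ι) : ‖stdVec ψ i‖ = 1 := by
  rw [@norm_eq_sqrt_re_inner ℂ, inner_stdVec, stdVec_apply_self, inner_delta]
  simp [ψ.map_one]

/-- Operators that commute with left translations. -/
def IsEquivariant (A : Pow ψ ι →L[ℂ] Pow ψ ι) : Prop :=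
  ∀ g x, A (powLeft ψ ι g x) = powLeft ψ ι g (A x)

namespace IsEquivariant

variable {A B : Pow ψ ι →L[ℂ] Pow ψ ι}

theorem one : IsEquivariant (1 : Pow ψ ι →L[ℂ] Pow ψ ι) := fun _ _ => rfl

theorem zero : IsEquivariant (0 : Pow ψ ι →L[ℂ] Pow ψ ι) := fun g x => by simp

theorem add (hA : IsEquivariant A) (hB : IsEquivariant B) : IsEquivariant (A + B) := fun g x => by
  rw [add_apply, hA, hB, add_apply, map_add]

theorem sub (hA : IsEquivariant A) (hB : IsEquivariant B) : IsEquivariant (A - B) := fun g x => by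
  rw [sub_apply, hA, hB, sub_apply, map_sub]

theorem mul (hA : IsEquivariant A) (hB : IsEquivariant B) : IsEquivariant (A * B) := fun g x => by
  rw [mul_apply_eq_comp, hB, hA, mul_apply_eq_comp]

theorem adjoint (hA : IsEquivariant A) : IsEquivariant (adjoint A) := fun g x => by
  refine ext_inner_right ℂ fun y => ?_
  rw [adjoint_inner_left, inner_powLeft, inner_powLeft, adjoint_inner_left, hA]

/-- An equivariant operator is determined by its matrix of entries (A e_s)_t in ℓ^ψ(G); passing to
the adjoint transposes this matrix and applies the involution to each entry. -/
theorem adjoint_stdVec_apply (hA : IsEquivariant A) (s t : ι) :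
    ContinuousLinearMap.adjoint A (stdVec ψ t) s = ellStar ψ (A (stdVec ψ s) t) := by
  refine eq_of_inner_delta ψ fun g => ?_
  rw [← inner_powLeft_stdVec, adjoint_inner_right, hA, ← inner_conj_symm, inner_stdVec,
    powLeft_apply, inner_conj_symm, inner_left, left_delta, mul_one, ← inner_ellStar,
    ellStar_delta, inv_inv]

/-- The trace property. -/
theorem traceAt_mul_comm (hA : IsEquivariant A) (hB : IsEquivariant B) :
    traceAt (stdVec (ι := ι) ψ) (A * B) = traceAt (stdVec (ι := ι) ψ) (B * A) := by
  simp only [traceAt, mul_apply_eq_comp]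
  -- In terms of matrix entries the trace is ∑ ⟪(A e_s)_t*, (B e_t)_s⟫. It is symmetric in A and B
  -- since the involution is antiunitary.
  have h1 (A B : Pow ψ ι →L[ℂ] Pow ψ ι) (hA : IsEquivariant A) (t : ι) :
      inner ℂ (stdVec ψ t) (A (B (stdVec ψ t))) =
        ∑ s, inner ℂ (ellStar ψ (A (stdVec ψ s) t)) (B (stdVec ψ t) s) := by
    rw [← adjoint_inner_left, PiLp.inner_apply]
    simp only [hA.adjoint_stdVec_apply]
  simp only [h1 A B hA, h1 B A hB]
  rw [Finset.sum_comm]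
  refine Finset.sum_congr rfl fun s _ => Finset.sum_congr rfl fun t _ => ?_
  rw [← inner_ellStar, ellStar_ellStar]

/-- The same C serves both products, so equality of the traces of the two powers reduces to that of
CA and AC. -/
theorem exists_pow_eq (hA : IsEquivariant A) (n : ℕ) :
    ∃ C, IsEquivariant C ∧ (1 - ContinuousLinearMap.adjoint A * A) ^ n = 1 - C * A ∧
      (1 - A * ContinuousLinearMap.adjoint A) ^ n = 1 - A * C := by
  induction n with
  | zero => exact ⟨0, zero, by simp, by simp⟩
  | succ n ih =>
    obtain ⟨C, hC, h1, h2⟩ := ih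
    refine ⟨C + ContinuousLinearMap.adjoint A - C * A * ContinuousLinearMap.adjoint A,
      (hC.add hA.adjoint).sub ((hC.mul hA).mul hA.adjoint), ?_, ?_⟩
    · rw [pow_succ, h1]
      simp only [mul_sub, sub_mul, add_mul, mul_assoc, mul_one, one_mul]
      abel
    · rw [pow_succ, h2]
      simp only [mul_sub, sub_mul, mul_add, mul_assoc, mul_one, one_mul]
      abel

theorem traceAt_ker_eq (hA : IsEquivariant A) (h : ‖A‖ ≤ 1) :
    traceAt (stdVec (ι := ι) ψ) A.ker.starProjection =
      traceAt (stdVec (ι := ι) ψ) (ContinuousLinearMap.adjoint A).ker.starProjection := by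
  refine PsiBetti.traceAt_ker_eq _ A h fun n => ?_
  obtain ⟨C, hC, h1, h2⟩ := hA.exists_pow_eq n
  have hsub (S : Pow ψ ι →L[ℂ] Pow ψ ι) : traceAt (stdVec (ι := ι) ψ) (1 - S) =
      traceAt (stdVec (ι := ι) ψ) 1 - traceAt (stdVec (ι := ι) ψ) S := by
    simp only [traceAt, sub_apply, inner_sub_right, Finset.sum_sub_distrib]
  rw [h1, h2, hsub, hsub, hC.traceAt_mul_comm hA]

theorem starProjection (V : Submodule ℂ (Pow ψ ι)) [V.HasOrthogonalProjection]
    (hV : ∀ g, ∀ x ∈ V, powLeft ψ ι g x ∈ V) : IsEquivariant V.starProjection := fun g x => by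
  refine Submodule.eq_starProjection_of_mem_of_inner_eq_zero
    (hV g _ (V.starProjection_apply_mem x)) fun w hw => ?_
  rw [← map_sub, inner_powLeft]
  exact V.starProjection_inner_eq_zero x _ (hV _ _ hw)

end IsEquivariant

open Classical in
/-- The projection of `ℓ^ψ(G)^ι` to the coordinates in `p`. -/
def coordProj (ψ : GroupCharacter G) (p : Set ι) : Pow ψ ι →L[ℂ] Pow ψ ι :=
  powLift fun i => if i ∈ p then PiLp.proj 2 (fun _ : ι => Ell ψ) i else 0

theorem coordProj_apply_of_mem (p : Set ι) (x : Pow ψ ι) {i : ι} (hi : i ∈ p) :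
    coordProj ψ p x i = x i := by
  simp [coordProj, hi]

theorem coordProj_apply_of_notMem (p : Set ι) (x : Pow ψ ι) {i : ι} (hi : i ∉ p) :
    coordProj ψ p x i = 0 := by
  simp [coordProj, hi]

theorem isEquivariant_coordProj (p : Set ι) : IsEquivariant (coordProj ψ p) := fun g x => by
  ext i
  by_cases hi : i ∈ p
  · simp only [coordProj_apply_of_mem p _ hi, powLeft_apply]
  · simp only [coordProj_apply_of_notMem p _ hi, powLeft_apply, map_zero]

theorem norm_coordProj_apply_le (p : Set ι) (x : Pow ψ ι) : ‖coordProj ψ p x‖ ≤ ‖x‖ := by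
  refine le_of_sq_le_sq ?_ (norm_nonneg _)
  rw [PiLp.norm_sq_eq_of_L2, PiLp.norm_sq_eq_of_L2]
  refine Finset.sum_le_sum fun i _ => ?_
  by_cases hi : i ∈ p
  · rw [coordProj_apply_of_mem p _ hi]
  · rw [coordProj_apply_of_notMem p _ hi]
    simp

/-- Additivity of the dimension for the projection of an invariant subspace to some of the
coordinates. -/
theorem dimAt_eq_add (V : Submodule ℂ (Pow ψ ι)) (hc : IsClosed (V : Set (Pow ψ ι)))
    (hV : ∀ g, ∀ x ∈ V, powLeft ψ ι g x ∈ V) (p : Set ι) :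
    dimAt (stdVec ψ) V = dimAt (stdVec ψ) (V ⊓ (coordProj ψ p).ker) +
      dimAt (stdVec ψ) (V.map (coordProj ψ p : Pow ψ ι →ₗ[ℂ] Pow ψ ι)) := by
  set Q := coordProj ψ p with hQ
  have : CompleteSpace V := hc.completeSpace_coe
  have hc0 : IsClosed ((V ⊓ Q.ker : Submodule ℂ (Pow ψ ι)) : Set (Pow ψ ι)) :=
    hc.inter Q.isClosed_ker
  have : CompleteSpace (V ⊓ Q.ker : Submodule ℂ (Pow ψ ι)) := hc0.completeSpace_coe
  -- The kernel of T is Vᗮ ⊕ (V ⊓ ker Q), and the kernel of T† is the orthogonal complement of Q V.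
  -- Equality of their dimensions is the claim.
  set T := Q * V.starProjection with hT
  have hTe : IsEquivariant T := (isEquivariant_coordProj p).mul (.starProjection V hV)
  have hTn : ‖T‖ ≤ 1 := by
    refine ContinuousLinearMap.opNorm_le_bound _ zero_le_one fun x => ?_
    rw [one_mul]
    exact (norm_coordProj_apply_le p _).trans (V.norm_starProjection_apply_le x)
  have hrange : T.range = V.map (Q : Pow ψ ι →ₗ[ℂ] Pow ψ ι) := by
    ext y
    constructor
    · rintro ⟨x, rfl⟩
      exact ⟨V.starProjection x, V.starProjection_apply_mem x, rfl⟩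
    · rintro ⟨x, hx, rfl⟩
      refine ⟨x, ?_⟩
      change Q (V.starProjection x) = Q x
      rw [Submodule.starProjection_eq_self_iff.2 hx]
  have hker (x : Pow ψ ι) : T.ker.starProjection x =
      x - V.starProjection x + (V ⊓ Q.ker).starProjection x := by
    have hx := (V ⊓ Q.ker).starProjection_apply_mem x
    refine Submodule.eq_starProjection_of_mem_of_inner_eq_zero ?_ fun w hw => ?_
    · change Q (V.starProjection _) = 0
      rw [map_add, map_sub, Submodule.starProjection_eq_self_iff.2 (V.starProjection_apply_mem x),
        sub_self, zero_add, Submodule.starProjection_eq_self_iff.2 hx.1]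
      exact hx.2
    · have hw' : V.starProjection w ∈ V ⊓ Q.ker := ⟨V.starProjection_apply_mem w, hw⟩
      have e1 : V.starProjection (V.starProjection x - (V ⊓ Q.ker).starProjection x) =
          V.starProjection x - (V ⊓ Q.ker).starProjection x :=
        Submodule.starProjection_eq_self_iff.2
          (V.sub_mem (V.starProjection_apply_mem x) hx.1)
      have e2 : x - (x - V.starProjection x + (V ⊓ Q.ker).starProjection x) =
          V.starProjection x - (V ⊓ Q.ker).starProjection x := by abel
      rw [e2, ← e1, Submodule.inner_starProjection_left_eq_right]
      have e3 := (V ⊓ Q.ker).starProjection_inner_eq_zero x _ hw'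
      have e4 := V.starProjection_inner_eq_zero x _ hw'.1
      rw [← sub_sub_sub_cancel_left _ _ x, inner_sub_left, e3, e4, sub_zero]
  have h1 := dimAt_add_orthogonal (stdVec (ι := ι) ψ) T.range
  have h2 := hTe.traceAt_ker_eq hTn
  have h3 : traceAt (stdVec (ι := ι) ψ) T.ker.starProjection =
      traceAt (stdVec (ι := ι) ψ) 1 - traceAt (stdVec (ι := ι) ψ) V.starProjection +
        traceAt (stdVec (ι := ι) ψ) (V ⊓ Q.ker).starProjection := by
    simp only [traceAt, hker, inner_add_right, inner_sub_right, Finset.sum_sub_distrib,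
      Finset.sum_add_distrib, one_apply_eq_self]
  have h4 : traceAt (stdVec (ι := ι) ψ) 1 = ((∑ i : ι, ‖stdVec ψ i‖ ^ 2 : ℝ) : ℂ) := by
    rw [traceAt, Complex.ofReal_sum]
    refine Finset.sum_congr rfl fun i _ => ?_
    rw [one_apply_eq_self, inner_self_eq_norm_sq_to_K]
    simp
  rw [h3, h4, traceAt_starProjection, traceAt_starProjection, traceAt_starProjection] at h2
  rw [T.orthogonal_range, dimAt_eq_of_isClosed _ _ (ContinuousLinearMap.isClosed_ker _)] at h1
  rw [dimAt_eq_of_isClosed _ _ hc, dimAt_eq_of_isClosed _ _ hc0, ← hrange]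
  norm_cast at h2
  linarith

end Pow

/-! ### The complex of a finite family of group elements -/

section Complex

open ContinuousLinearMap

variable {G : Type u} [Group G] {ι : Type*}

/-- The map `ℂ[G]^ι → ℓ^ψ(G)^ι`. -/
def toPow (ψ : GroupCharacter G) (ι : Type*) :
    (ι → MonoidAlgebra ℂ G) →ₗ[ℂ] Pow ψ ι where
  toFun z := WithLp.toLp 2 fun i => toEll ψ (z i)
  map_add' x y := by ext i; simp
  map_smul' r x := by ext i; simp

@[simp]
theorem toPow_apply (ψ : GroupCharacter G) (z : ι → MonoidAlgebra ℂ G) (i : ι) :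
    toPow ψ ι z i = toEll ψ (z i) := rfl

theorem right_toEll (ψ : GroupCharacter G) (g : G) (w : MonoidAlgebra ℂ G) :
    right ψ g (toEll ψ w) = toEll ψ (w * MonoidAlgebra.of ℂ G g) := by
  induction w using MonoidAlgebra.induction_linear with
  | zero => simp
  | add x y hx hy => simp only [map_add, add_mul, hx, hy]
  | single h c =>
    rw [MonoidAlgebra.of_apply, MonoidAlgebra.single_mul_single, toEll_single, toEll_single,
      map_smul, right_delta, mul_one]

theorem left_toEll (ψ : GroupCharacter G) (g : G) (w : MonoidAlgebra ℂ G) :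
    left ψ g (toEll ψ w) = toEll ψ (MonoidAlgebra.of ℂ G g * w) := by
  induction w using MonoidAlgebra.induction_linear with
  | zero => simp
  | add x y hx hy => simp only [map_add, mul_add, hx, hy]
  | single h c =>
    rw [MonoidAlgebra.of_apply, MonoidAlgebra.single_mul_single, toEll_single, toEll_single,
      map_smul, left_delta, one_mul]

theorem rightAlg_toEll (ψ : GroupCharacter G) (z w : MonoidAlgebra ℂ G) :
    rightAlg ψ z (toEll ψ w) = toEll ψ (w * z) := by
  conv_rhs => rw [← z.sum_coeff_single]
  rw [rightAlg, Finsupp.sum, Finsupp.sum, Finset.mul_sum, map_sum, sum_apply]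
  refine Finset.sum_congr rfl fun g _ => ?_
  rw [smul_apply, right_toEll, ← map_smul, ← mul_smul_comm,
    MonoidAlgebra.of_apply, MonoidAlgebra.smul_single', mul_one]

/-- The map `x ↦ (x z_i)_i`. -/
def rowMap (ψ : GroupCharacter G) (z : ι → MonoidAlgebra ℂ G) : Ell ψ →L[ℂ] Pow ψ ι :=
  powLift fun i => rightAlg ψ (z i)

theorem rowMap_toEll (ψ : GroupCharacter G) (z : ι → MonoidAlgebra ℂ G) (w : MonoidAlgebra ℂ G) :
    rowMap ψ z (toEll ψ w) = toPow ψ ι (fun i => w * z i) := by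
  ext i
  simp only [rowMap, powLift_apply, rightAlg_toEll, toPow_apply]

variable [Fintype ι]

/-- The map `ℓ^ψ(G)^ι → ℓ^ψ(G)`, `(x_i) ↦ ∑ x_i (g_i - 1)`. -/
def famBoundary (ψ : GroupCharacter G) (g : ι → G) : Pow ψ ι →L[ℂ] Ell ψ :=
  ∑ i, (right ψ (g i) - ContinuousLinearMap.id ℂ (Ell ψ)) ∘L
    PiLp.proj (𝕜 := ℂ) 2 (fun _ : ι => Ell ψ) i

theorem famBoundary_apply (ψ : GroupCharacter G) (g : ι → G) (x : Pow ψ ι) :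
    famBoundary ψ g x = ∑ i, (right ψ (g i) (x i) - x i) := by
  simp [famBoundary]

/-- The map `ℂ[G]^ι → ℂ[G]`, `(z_i) ↦ ∑ z_i (g_i - 1)`. -/
def famAlgBoundary (g : ι → G) : (ι → MonoidAlgebra ℂ G) →ₗ[ℂ] MonoidAlgebra ℂ G :=
  ∑ i, (LinearMap.mulRight ℂ (MonoidAlgebra.of ℂ G (g i) - 1)) ∘ₗ LinearMap.proj i

theorem famAlgBoundary_apply (g : ι → G) (z : ι → MonoidAlgebra ℂ G) :
    famAlgBoundary g z = ∑ i, z i * (MonoidAlgebra.of ℂ G (g i) - 1) := by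
  simp [famAlgBoundary]

theorem famAlgBoundary_smul (g : ι → G) (w : MonoidAlgebra ℂ G) (z : ι → MonoidAlgebra ℂ G) :
    famAlgBoundary g (fun i => w * z i) = w * famAlgBoundary g z := by
  simp only [famAlgBoundary_apply, Finset.mul_sum, mul_assoc]

/-- The image in `ℓ^ψ(G)^ι` of the space of finite cycles. -/
def famCycles (ψ : GroupCharacter G) (g : ι → G) : Submodule ℂ (Pow ψ ι) :=
  (LinearMap.ker (famAlgBoundary g)).map (toPow ψ ι)

theorem toPow_mem_famCycles (ψ : GroupCharacter G) (g : ι → G) (z : ι → MonoidAlgebra ℂ G)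
    (hz : famAlgBoundary g z = 0) : toPow ψ ι z ∈ famCycles ψ g :=
  Submodule.mem_map_of_mem hz

/-- The dimension of the reduced first homology of the complex of a finite family. -/
def famBetti (ψ : GroupCharacter G) (g : ι → G) : ℝ :=
  dimAt (stdVec ψ) (famBoundary ψ g).ker - dimAt (stdVec ψ) (famCycles ψ g)

theorem famBoundary_toPow (ψ : GroupCharacter G) (g : ι → G) (z : ι → MonoidAlgebra ℂ G) :
    famBoundary ψ g (toPow ψ ι z) = toEll ψ (famAlgBoundary g z) := by
  simp only [famBoundary_apply, famAlgBoundary_apply, toPow_apply, right_toEll, mul_sub, mul_one,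
    map_sum, map_sub]

theorem famCycles_le_ker (ψ : GroupCharacter G) (g : ι → G) :
    famCycles ψ g ≤ (famBoundary ψ g).ker := by
  rintro _ ⟨z, hz, rfl⟩
  change famBoundary ψ g (toPow ψ ι z) = 0
  rw [famBoundary_toPow, LinearMap.mem_ker.1 hz, map_zero]

theorem powLeft_toPow (ψ : GroupCharacter G) (g : G) (z : ι → MonoidAlgebra ℂ G) :
    powLeft ψ ι g (toPow ψ ι z) = toPow ψ ι (fun i => MonoidAlgebra.of ℂ G g * z i) := by
  ext i
  simp only [powLeft_apply, left_toEll, toPow_apply]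

theorem powLeft_mem_ker (ψ : GroupCharacter G) (g : ι → G) (h : G) (x : Pow ψ ι)
    (hx : x ∈ (famBoundary ψ g).ker) : powLeft ψ ι h x ∈ (famBoundary ψ g).ker := by
  have h1 : famBoundary ψ g (powLeft ψ ι h x) = left ψ h (famBoundary ψ g x) := by
    simp only [famBoundary_apply, powLeft_apply, map_sum, map_sub, left_right]
  have h2 : famBoundary ψ g x = 0 := hx
  change famBoundary ψ g (powLeft ψ ι h x) = 0
  rw [h1, h2, map_zero]

theorem powLeft_mem_famCycles_closure (ψ : GroupCharacter G) (g : ι → G) (h : G) (x : Pow ψ ι)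
    (hx : x ∈ (famCycles ψ g).topologicalClosure) :
    powLeft ψ ι h x ∈ (famCycles ψ g).topologicalClosure := by
  have hle : (famCycles ψ g).topologicalClosure ≤
      (famCycles ψ g).topologicalClosure.comap (powLeft ψ ι h : Pow ψ ι →ₗ[ℂ] Pow ψ ι) := by
    refine Submodule.topologicalClosure_minimal _ ?_
      ((famCycles ψ g).isClosed_topologicalClosure.preimage (powLeft ψ ι h).continuous)
    rintro _ ⟨z, hz, rfl⟩
    change powLeft ψ ι h (toPow ψ ι z) ∈ (famCycles ψ g).topologicalClosure
    rw [powLeft_toPow]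
    refine Submodule.le_topologicalClosure _ (toPow_mem_famCycles ψ g _ ?_)
    rw [famAlgBoundary_smul, LinearMap.mem_ker.1 hz, mul_zero]
  exact hle hx

theorem boundaryTwo_single (ψ : GroupCharacter G) (S : Finset G) (z : algCycles S) (x : Ell ψ) :
    boundaryTwo ψ S (Finsupp.single z x) = rowMap ψ z.1 x := by
  rw [boundaryTwo, Finsupp.lsum_single]
  rfl

/-- For w in ℂ[G] and a finite cycle z, the image wz is again a finite cycle, and ℂ[G] is dense in
ℓ^ψ(G). Conversely, z is the image of the coefficient 1. -/
theorem topologicalClosure_range_boundaryTwo (ψ : GroupCharacter G) (S : Finset G) :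
    (LinearMap.range (boundaryTwo ψ S)).topologicalClosure =
      (famCycles ψ fun s : S => (s : G)).topologicalClosure := by
  refine le_antisymm (Submodule.topologicalClosure_minimal _ ?_
    (Submodule.isClosed_topologicalClosure _)) (Submodule.topologicalClosure_mono ?_)
  · rintro _ ⟨y, rfl⟩
    induction y using Finsupp.induction_linear with
    | zero => simp
    | add x y hx hy =>
      rw [map_add]
      exact Submodule.add_mem _ hx hy
    | single z x =>
      rw [boundaryTwo_single]
      refine (denseRange_toEll ψ).induction_on (p := fun x =>
        rowMap ψ z.1 x ∈ (famCycles ψ fun s : S => (s : G)).topologicalClosure) x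
        ((Submodule.isClosed_topologicalClosure _).preimage (rowMap ψ z.1).continuous) fun w => ?_
      rw [rowMap_toEll]
      refine Submodule.le_topologicalClosure _ (toPow_mem_famCycles ψ _ _ ?_)
      rw [famAlgBoundary_smul]
      have hz : famAlgBoundary (fun s : S => (s : G)) z.1 = 0 := z.2
      rw [hz, mul_zero]
  · rintro _ ⟨z, hz, rfl⟩
    refine ⟨Finsupp.single ⟨z, hz⟩ (toEll ψ 1), ?_⟩
    rw [boundaryTwo_single, rowMap_toEll]
    simp

theorem vnDim_eq_dimAt (ψ : GroupCharacter G) (S : Finset G) (V : Submodule ℂ (EllPow ψ S)) :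
    vnDim ψ S V = dimAt (stdVec (ι := S) ψ) V := by
  unfold vnDim dimAt
  refine Finset.sum_congr rfl fun s _ => ?_
  have h : basisVec ψ S s = stdVec (ι := S) ψ s := by
    unfold basisVec stdVec
    congr!
  rw [h, ← Submodule.inner_starProjection_left_eq_right,
    Submodule.re_inner_starProjection_eq_normSq]
  rfl

theorem vnDim_reducedHomologyOne (ψ : GroupCharacter G) (S : Finset G) :
    vnDim ψ S (reducedHomologyOne ψ S) = famBetti ψ fun s : S => (s : G) := by
  have hR : LinearMap.range (boundaryTwo ψ S) ≤ (famBoundary ψ fun s : S => (s : G)).ker := by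
    refine (Submodule.le_topologicalClosure _).trans ?_
    rw [topologicalClosure_range_boundaryTwo]
    exact Submodule.topologicalClosure_minimal _ (famCycles_le_ker ψ _)
      (ContinuousLinearMap.isClosed_ker _)
  have h := dimAt_topologicalClosure (stdVec (ι := S) ψ) (famCycles ψ fun s : S => (s : G))
  rw [← topologicalClosure_range_boundaryTwo, dimAt_topologicalClosure] at h
  rw [vnDim_eq_dimAt, famBetti, ← h]
  exact dimAt_inf_orthogonal _ _ _ (ContinuousLinearMap.isClosed_ker _) hR

theorem dimAt_add_orthogonal_stdVec {ψ : GroupCharacter G} (V : Submodule ℂ (Pow ψ ι)) :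
    dimAt (stdVec ψ) V + dimAt (stdVec ψ) Vᗮ = Fintype.card ι := by
  rw [dimAt_add_orthogonal]
  simp [norm_stdVec]

theorem inner_right (ψ : GroupCharacter G) (g : G) (x y : Ell ψ) :
    inner ℂ (right ψ g x) y = inner ℂ x (right ψ g⁻¹ y) := by
  have hu : ∀ a b, ψ ((a * g)⁻¹ * (b * g)) = ψ (a⁻¹ * b) := fun a b => by
    rw [← ψ.conj_eq (a⁻¹ * b) g⁻¹]
    congr 1
    group
  have h1 : right ψ g = ellMap ψ ψ (· * g) hu :=
    ext_delta ψ fun a => by rw [right_delta, ellMap_delta]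
  have h2 : right ψ g (right ψ g⁻¹ y) = y := by
    refine DFunLike.congr_fun
      (?_ : right ψ g ∘L right ψ g⁻¹ = ContinuousLinearMap.id ℂ (Ell ψ)) y
    exact ext_delta ψ fun a => by simp [right_delta]
  have h3 := inner_ellMap ψ ψ (· * g) hu x (right ψ g⁻¹ y)
  rw [← h1, h2] at h3
  exact h3

theorem adjoint_famBoundary (ψ : GroupCharacter G) (g : ι → G) :
    adjoint (famBoundary ψ g) =
      powLift fun i => right ψ (g i)⁻¹ - ContinuousLinearMap.id ℂ (Ell ψ) := by
  symm
  refine (eq_adjoint_iff _ _).2 fun x y => ?_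
  rw [PiLp.inner_apply, famBoundary_apply, inner_sum]
  refine Finset.sum_congr rfl fun i _ => ?_
  rw [powLift_apply, sub_apply, inner_sub_left, inner_sub_right, inner_right, inv_inv]
  rfl

/-- The dimension of the reduced homology does not increase under a homomorphism that preserves
characters. -/
theorem famBetti_comp_le {K : Type*} [Group K] (φ : GroupCharacter K) (ψ : GroupCharacter G)
    (f : K →* G) (hf : ∀ k, ψ (f k) = φ k) (g : ι → K) :
    famBetti ψ (fun i => f (g i)) ≤ famBetti φ g := by
  have hu : ∀ a b, ψ ((f a)⁻¹ * f b) = φ (a⁻¹ * b) := fun a b => by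
    rw [← hf, map_mul, map_inv]
  set F := ellMap φ ψ f hu
  set PF : Pow φ ι →L[ℂ] Pow ψ ι :=
    powLift fun i => F ∘L PiLp.proj (𝕜 := ℂ) 2 (fun _ : ι => Ell φ) i
  have hPF (x : Pow φ ι) (i : ι) : PF x i = F (x i) := rfl
  have hn (x : Pow φ ι) : ‖PF x‖ = ‖x‖ := by
    rw [PiLp.norm_eq_of_L2, PiLp.norm_eq_of_L2]
    simp only [hPF, F, norm_ellMap]
  have hstd (i : ι) : PF (stdVec φ i) = stdVec ψ i := by
    ext j
    rw [hPF]
    by_cases hj : j = i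
    · subst hj
      rw [stdVec_apply_self, stdVec_apply_self, ellMap_delta, map_one]
    · rw [stdVec_apply_of_ne hj, stdVec_apply_of_ne hj, map_zero]
  have hdim (V : Submodule ℂ (Pow φ ι)) (W : Submodule ℂ (Pow ψ ι))
      (h : ∀ v ∈ V, PF v ∈ W.topologicalClosure) :
      dimAt (stdVec φ) V ≤ dimAt (stdVec ψ) W := by
    refine Finset.sum_le_sum fun i _ => ?_
    have := norm_starProjection_closure_le PF (fun x => (hn x).le) V W h (stdVec φ i) (hn _)
    rw [hstd] at this
    gcongr
  have hF (k : K) (x : Ell φ) : F (right φ k x) = right ψ (f k) (F x) := by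
    refine DFunLike.congr_fun (?_ : F ∘L right φ k = right ψ (f k) ∘L F) x
    exact ext_delta φ fun a => by simp [F, right_delta, ellMap_delta]
  -- Mapping kernels to kernels would bound the dimension in the wrong direction. Instead, the
  -- orthogonal complement of the kernel is the closure of the range of the adjoint, and `PF`
  -- intertwines the adjoints.
  have h1 : dimAt (stdVec φ) (famBoundary φ g).kerᗮ ≤
      dimAt (stdVec ψ) (famBoundary ψ fun i => f (g i)).kerᗮ := by
    refine hdim _ _ ?_
    rw [orthogonal_ker, orthogonal_ker]
    refine Submodule.topologicalClosure_minimal (t := ((adjoint (famBoundary ψ fun i =>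
      f (g i))).range.topologicalClosure.topologicalClosure).comap (PF : Pow φ ι →ₗ[ℂ] Pow ψ ι))
      _ ?_ ((Submodule.isClosed_topologicalClosure _).preimage PF.continuous)
    rintro _ ⟨x, rfl⟩
    refine Submodule.le_topologicalClosure _ (Submodule.le_topologicalClosure _ ⟨F x, ?_⟩)
    change adjoint _ (F x) = PF (adjoint _ x)
    ext i
    rw [hPF, adjoint_famBoundary, adjoint_famBoundary, powLift_apply, powLift_apply]
    simp [hF]
  -- Applying f to the coefficients maps finite cycles to finite cycles.
  have h2 : dimAt (stdVec φ) (famCycles φ g) ≤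
      dimAt (stdVec ψ) (famCycles ψ fun i => f (g i)) := by
    refine hdim _ _ ?_
    rintro _ ⟨z, hz, rfl⟩
    have hz' : famAlgBoundary g z = 0 := hz
    have h3 : PF (toPow φ ι z) = toPow ψ ι fun i => (z i).mapDomain f := by
      ext i
      rw [hPF, toPow_apply, toPow_apply]
      exact ellMap_coe φ ψ f hu (z i).coeff
    rw [h3]
    refine Submodule.le_topologicalClosure _ (toPow_mem_famCycles ψ _ _ ?_)
    have h4 := congrArg (MonoidAlgebra.mapDomainRingHom ℂ f) hz'
    rw [famAlgBoundary_apply, map_sum, map_zero] at h4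
    rw [famAlgBoundary_apply, ← h4]
    refine Finset.sum_congr rfl fun i _ => ?_
    rw [map_mul, map_sub, map_one]
    simp
  have h3 := dimAt_add_orthogonal_stdVec (famBoundary φ g).ker
  have h4 := dimAt_add_orthogonal_stdVec (famBoundary ψ fun i => f (g i)).ker
  unfold famBetti
  linarith

end Complex

/-! ### Adding elements to a family -/

section Extend

open ContinuousLinearMap

variable {G : Type u} [Group G] {ψ : GroupCharacter G} {ι σ κ : Type*}
  (e : ι ⊕ σ ≃ κ)

/-- Restriction to the coordinates in the first summand. -/
def restrictInl [Fintype κ] (ψ : GroupCharacter G) (e : ι ⊕ σ ≃ κ) : Pow ψ κ →L[ℂ] Pow ψ ι :=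
  powLift fun i => PiLp.proj (𝕜 := ℂ) 2 (fun _ : κ => Ell ψ) (e (.inl i))

/-- Extension by zero from the coordinates in the first summand. -/
def extendInl [Fintype ι] (ψ : GroupCharacter G) (e : ι ⊕ σ ≃ κ) : Pow ψ ι →L[ℂ] Pow ψ κ :=
  powLift fun k => Sum.elim (fun i => PiLp.proj (𝕜 := ℂ) 2 (fun _ : ι => Ell ψ) i)
    (fun _ => 0) (e.symm k)

/-- The projection to the coordinates in the second summand. -/
def projInr [Fintype κ] (ψ : GroupCharacter G) (e : ι ⊕ σ ≃ κ) : Pow ψ κ →L[ℂ] Pow ψ κ :=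
  coordProj ψ (Set.range fun s => e (.inr s))

theorem ext_of_equiv {x y : Pow ψ κ} (h1 : ∀ i, x (e (.inl i)) = y (e (.inl i)))
    (h2 : ∀ s, x (e (.inr s)) = y (e (.inr s))) : x = y := by
  ext k
  obtain ⟨j, rfl⟩ := e.surjective k
  cases j with
  | inl i => exact h1 i
  | inr s => exact h2 s

@[simp]
theorem restrictInl_apply [Fintype κ] (x : Pow ψ κ) (i : ι) : restrictInl ψ e x i = x (e (.inl i)) := rfl

@[simp]
theorem extendInl_inl [Fintype ι] (x : Pow ψ ι) (i : ι) : extendInl ψ e x (e (.inl i)) = x i := by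
  simp [extendInl]

@[simp]
theorem extendInl_inr [Fintype ι] (x : Pow ψ ι) (s : σ) : extendInl ψ e x (e (.inr s)) = 0 := by
  simp [extendInl]

@[simp]
theorem projInr_inl [Fintype κ] (x : Pow ψ κ) (i : ι) : projInr ψ e x (e (.inl i)) = 0 :=
  coordProj_apply_of_notMem _ _ (by simp)

@[simp]
theorem projInr_inr [Fintype κ] (x : Pow ψ κ) (s : σ) : projInr ψ e x (e (.inr s)) = x (e (.inr s)) :=
  coordProj_apply_of_mem _ _ (by simp)

theorem apply_inr_of_mem_ker [Fintype κ] {x : Pow ψ κ} (hx : x ∈ (projInr ψ e).ker) (s : σ) :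
    x (e (.inr s)) = 0 := by
  have h : projInr ψ e x = 0 := hx
  rw [← projInr_inr, h]
  rfl

theorem restrictInl_stdVec [Fintype κ] (i : ι) : restrictInl ψ e (stdVec ψ (e (.inl i))) = stdVec ψ i := by
  ext j
  rw [restrictInl_apply]
  by_cases hj : j = i
  · rw [hj, stdVec_apply_self, stdVec_apply_self]
  · rw [stdVec_apply_of_ne hj, stdVec_apply_of_ne (by simpa using hj)]

theorem extendInl_stdVec [Fintype ι] (i : ι) : extendInl ψ e (stdVec ψ i) = stdVec ψ (e (.inl i)) := by
  refine ext_of_equiv e (fun j => ?_) (fun s => ?_)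
  · rw [extendInl_inl]
    by_cases hj : j = i
    · rw [hj, stdVec_apply_self, stdVec_apply_self]
    · rw [stdVec_apply_of_ne hj, stdVec_apply_of_ne (by simpa using hj)]
  · rw [extendInl_inr, stdVec_apply_of_ne (by simp)]

theorem dimAt_ker_eq_add [Fintype κ] (ψ : GroupCharacter G) (h : κ → G) :
    dimAt (stdVec (ι := κ) ψ) (famBoundary ψ h).ker =
      dimAt (stdVec (ι := κ) ψ) ((famBoundary ψ h).ker ⊓ (projInr ψ e).ker) +
        dimAt (stdVec (ι := κ) ψ)
          ((famBoundary ψ h).ker.map (projInr ψ e : Pow ψ κ →ₗ[ℂ] Pow ψ κ)) :=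
  dimAt_eq_add (famBoundary ψ h).ker (ContinuousLinearMap.isClosed_ker _)
    (fun g x hx => powLeft_mem_ker ψ h g x hx) _

theorem dimAt_famCycles_eq_add [Fintype κ] (ψ : GroupCharacter G) (h : κ → G) :
    dimAt (stdVec (ι := κ) ψ) (famCycles ψ h) =
      dimAt (stdVec (ι := κ) ψ) ((famCycles ψ h).topologicalClosure ⊓ (projInr ψ e).ker) +
        dimAt (stdVec (ι := κ) ψ)
          ((famCycles ψ h).topologicalClosure.map (projInr ψ e : Pow ψ κ →ₗ[ℂ] Pow ψ κ)) := by
  rw [← dimAt_topologicalClosure]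
  exact dimAt_eq_add (famCycles ψ h).topologicalClosure (Submodule.isClosed_topologicalClosure _)
    (fun g x hx => powLeft_mem_famCycles_closure ψ h g x hx) _

variable [Fintype ι] [Fintype σ] [Fintype κ]

theorem sum_eq_add_of_equiv {M : Type*} [AddCommMonoid M] (f : κ → M) :
    ∑ k, f k = ∑ i, f (e (.inl i)) + ∑ s, f (e (.inr s)) := by
  rw [← e.sum_comp, Fintype.sum_sum_type]

theorem norm_restrictInl_le (x : Pow ψ κ) : ‖restrictInl ψ e x‖ ≤ ‖x‖ := by
  refine le_of_sq_le_sq ?_ (norm_nonneg _)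
  rw [PiLp.norm_sq_eq_of_L2, PiLp.norm_sq_eq_of_L2, sum_eq_add_of_equiv e]
  exact le_add_of_nonneg_right (by positivity)

theorem norm_extendInl (x : Pow ψ ι) : ‖extendInl ψ e x‖ = ‖x‖ := by
  rw [PiLp.norm_eq_of_L2, PiLp.norm_eq_of_L2, sum_eq_add_of_equiv e]
  simp

theorem starProjection_stdVec_eq_zero (U : Submodule ℂ (Pow ψ κ)) (k : κ)
    (hU : ∀ x ∈ U, x k = 0) : U.topologicalClosure.starProjection (stdVec ψ k) = 0 := by
  rw [Submodule.starProjection_apply_eq_zero_iff, Submodule.orthogonal_closure,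
    Submodule.mem_orthogonal']
  intro x hx
  rw [inner_stdVec, hU x hx, inner_zero_right]

/-- Since U vanishes on the second block, only the standard vectors of the first block contribute,
and restriction is a contraction preserving their norms. -/
theorem dimAt_le_of_restrictInl (U : Submodule ℂ (Pow ψ κ)) (W : Submodule ℂ (Pow ψ ι))
    (hU : U ≤ (projInr ψ e).ker) (h : ∀ x ∈ U, restrictInl ψ e x ∈ W.topologicalClosure) :
    dimAt (stdVec ψ) U ≤ dimAt (stdVec ψ) W := by
  have h0 (s : σ) : U.topologicalClosure.starProjection (stdVec ψ (e (.inr s))) = 0 :=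
    starProjection_stdVec_eq_zero U _ fun x hx => apply_inr_of_mem_ker e (hU hx) s
  rw [dimAt, dimAt, sum_eq_add_of_equiv e]
  simp only [h0, norm_zero, ne_eq, OfNat.ofNat_ne_zero, not_false_eq_true, zero_pow,
    Finset.sum_const_zero, add_zero]
  refine Finset.sum_le_sum fun i _ => ?_
  have := norm_starProjection_closure_le (restrictInl ψ e) (norm_restrictInl_le e) U W h
    (stdVec ψ (e (.inl i))) (by rw [restrictInl_stdVec, norm_stdVec, norm_stdVec])
  rw [restrictInl_stdVec] at this
  gcongr

theorem dimAt_le_of_extendInl (W : Submodule ℂ (Pow ψ ι)) (U : Submodule ℂ (Pow ψ κ))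
    (h : ∀ x ∈ W, extendInl ψ e x ∈ U.topologicalClosure) :
    dimAt (stdVec ψ) W ≤ dimAt (stdVec ψ) U := by
  rw [dimAt, dimAt, sum_eq_add_of_equiv e]
  refine le_add_of_le_of_nonneg (Finset.sum_le_sum fun i _ => ?_) (by positivity)
  have := norm_starProjection_closure_le (extendInl ψ e) (fun x => (norm_extendInl e x).le) W U h
    (stdVec ψ i) (norm_extendInl e _)
  rw [extendInl_stdVec] at this
  gcongr

theorem dimAt_map_projInr_le (V : Submodule ℂ (Pow ψ κ)) :
    dimAt (stdVec ψ) (V.map (projInr ψ e : Pow ψ κ →ₗ[ℂ] Pow ψ κ)) ≤ Fintype.card σ := by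
  rw [dimAt, sum_eq_add_of_equiv e]
  have h0 (i : ι) : (V.map (projInr ψ e : Pow ψ κ →ₗ[ℂ] Pow ψ κ)).topologicalClosure.starProjection
      (stdVec ψ (e (.inl i))) = 0 := by
    refine starProjection_stdVec_eq_zero _ _ ?_
    rintro _ ⟨x, -, rfl⟩
    exact projInr_inl e x i
  simp only [h0, norm_zero, ne_eq, OfNat.ofNat_ne_zero, not_false_eq_true, zero_pow,
    Finset.sum_const_zero, zero_add]
  refine (Finset.sum_le_card_nsmul _ _ 1 fun s _ => ?_).trans (by simp)
  refine pow_le_one₀ (norm_nonneg _) ?_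
  exact (Submodule.norm_starProjection_apply_le _ _).trans (norm_stdVec _).le

/-- Each standard vector of the second block is within squared distance ε of the projected space,
hence contributes at least 1 - ε. -/
theorem le_dimAt_map_projInr (V : Submodule ℂ (Pow ψ κ)) (ε : ℝ)
    (h : ∀ s, ∃ x ∈ V, (∀ t ≠ s, x (e (.inr t)) = 0) ∧ ‖delta ψ 1 - x (e (.inr s))‖ ^ 2 ≤ ε) :
    Fintype.card σ * (1 - ε) ≤
      dimAt (stdVec ψ) (V.map (projInr ψ e : Pow ψ κ →ₗ[ℂ] Pow ψ κ)) := by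
  rw [dimAt, sum_eq_add_of_equiv e]
  refine le_add_of_nonneg_of_le (by positivity) ?_
  rw [← nsmul_eq_mul]
  refine Finset.card_nsmul_le_sum _ _ _ fun s _ => ?_
  obtain ⟨x, hx, h0, h1⟩ := h s
  have h2 := one_sub_le_norm_starProjection_sq
    (V.map (projInr ψ e : Pow ψ κ →ₗ[ℂ] Pow ψ κ)).topologicalClosure (stdVec ψ (e (.inr s)))
    (projInr ψ e x) (Submodule.le_topologicalClosure _ (Submodule.mem_map_of_mem hx))
  have h3 : ‖stdVec ψ (e (.inr s)) - projInr ψ e x‖ ^ 2 = ‖delta ψ 1 - x (e (.inr s))‖ ^ 2 := by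
    rw [PiLp.norm_sq_eq_of_L2, Finset.sum_eq_single (e (.inr s))]
    · rw [PiLp.sub_apply, stdVec_apply_self, projInr_inr]
    · intro k _ hk
      rw [PiLp.sub_apply, stdVec_apply_of_ne hk]
      obtain ⟨j, rfl⟩ := e.surjective k
      cases j with
      | inl i => simp
      | inr t =>
        rw [projInr_inr, h0 t fun h => hk (by rw [h])]
        simp
    · simp
  rw [h3, norm_stdVec] at h2
  linarith

theorem famAlgBoundary_elim (h : κ → G) (c : ι → MonoidAlgebra ℂ G)
    (d : σ → MonoidAlgebra ℂ G) :
    famAlgBoundary h (fun k => Sum.elim c d (e.symm k)) =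
      famAlgBoundary (fun i => h (e (.inl i))) c + famAlgBoundary (fun s => h (e (.inr s))) d := by
  simp only [famAlgBoundary_apply, sum_eq_add_of_equiv e, Equiv.symm_apply_apply, Sum.elim_inl,
    Sum.elim_inr]

/-- A cycle with a prescribed coordinate in the second summand. -/
theorem exists_cycle (h : κ → G) (s : σ) (w : MonoidAlgebra ℂ G)
    (hw : w * (MonoidAlgebra.of ℂ G (h (e (.inr s))) - 1) ∈
      LinearMap.range (famAlgBoundary fun i => h (e (.inl i)))) :
    ∃ z, famAlgBoundary h z = 0 ∧ z (e (.inr s)) = w ∧ ∀ t ≠ s, z (e (.inr t)) = 0 := by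
  classical
  obtain ⟨c, hc⟩ := hw
  -- The entries -c in the first block cancel the boundary of the entry w at s.
  refine ⟨fun k => Sum.elim (-c) (Pi.single s w) (e.symm k), ?_, by simp, fun t ht => by simp [ht]⟩
  rw [famAlgBoundary_elim, map_neg, hc, famAlgBoundary_apply, Finset.sum_eq_single s]
  · simp
  · intro t _ ht
    simp [ht]
  · simp

variable (ψ)

/-- Split kernel and cycles along the second block. There the kernel has dimension at most |σ| and
the cycles at least |σ|(1 - ε). On the first block, kernel vectors restrict to kernel vectors of the
smaller family, and its cycles extend by zero. -/
theorem famBetti_le_add (h : κ → G) (ε : ℝ)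
    (hw : ∀ s, ∃ w, w * (MonoidAlgebra.of ℂ G (h (e (.inr s))) - 1) ∈
      LinearMap.range (famAlgBoundary fun i => h (e (.inl i))) ∧
        ‖delta ψ 1 - toEll ψ w‖ ^ 2 ≤ ε) :
    famBetti ψ h ≤ famBetti ψ (fun i => h (e (.inl i))) + Fintype.card σ * ε := by
  have h1 := dimAt_ker_eq_add e ψ h
  have h2 := dimAt_famCycles_eq_add e ψ h
  have h3 : dimAt (stdVec (ι := κ) ψ) ((famBoundary ψ h).ker ⊓ (projInr ψ e).ker) ≤
      dimAt (stdVec ψ) (famBoundary ψ fun i => h (e (.inl i))).ker := by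
    refine dimAt_le_of_restrictInl e _ _ inf_le_right fun x hx => ?_
    refine Submodule.le_topologicalClosure _ ?_
    have hx1 : famBoundary ψ h x = 0 := hx.1
    change famBoundary ψ _ (restrictInl ψ e x) = 0
    rw [famBoundary_apply, sum_eq_add_of_equiv e] at hx1
    simp only [apply_inr_of_mem_ker e hx.2, map_zero, sub_zero, Finset.sum_const_zero,
      add_zero] at hx1
    simpa only [famBoundary_apply, restrictInl_apply] using hx1
  have h4 := dimAt_map_projInr_le e (famBoundary ψ h).ker
  have h5 : dimAt (stdVec ψ) (famCycles ψ fun i => h (e (.inl i))) ≤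
      dimAt (stdVec (ι := κ) ψ) ((famCycles ψ h).topologicalClosure ⊓ (projInr ψ e).ker) := by
    refine dimAt_le_of_extendInl e _ _ ?_
    rintro _ ⟨z, hz, rfl⟩
    refine Submodule.le_topologicalClosure _ ⟨?_, ?_⟩
    · have h6 : extendInl ψ e (toPow ψ ι z) =
          toPow ψ κ (fun k => Sum.elim z (0 : σ → MonoidAlgebra ℂ G) (e.symm k)) := by
        refine ext_of_equiv e (fun j => ?_) (fun s => ?_) <;> simp
      rw [h6]
      refine Submodule.le_topologicalClosure _ (toPow_mem_famCycles ψ _ _ ?_)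
      rw [famAlgBoundary_elim, LinearMap.mem_ker.1 hz, map_zero, add_zero]
    · change projInr ψ e _ = 0
      refine ext_of_equiv e (fun j => ?_) (fun s => ?_) <;> simp
  have h6 := le_dimAt_map_projInr e (famCycles ψ h).topologicalClosure ε fun s => by
    obtain ⟨w, hw1, hw2⟩ := hw s
    obtain ⟨z, hz, hzs, hzt⟩ := exists_cycle e h s w hw1
    refine ⟨toPow ψ κ z, Submodule.le_topologicalClosure _ (toPow_mem_famCycles ψ h z hz),
      fun t ht => ?_, ?_⟩
    · rw [toPow_apply, hzt t ht, map_zero]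
    · rwa [toPow_apply, hzs]
  unfold famBetti
  linarith

/-- The converse for redundant elements: the kernel now fills the second block completely, while the
cycles contribute at most |σ| there. -/
theorem famBetti_inl_le (h : κ → G)
    (hw : ∀ s, MonoidAlgebra.of ℂ G (h (e (.inr s))) - 1 ∈
      LinearMap.range (famAlgBoundary fun i => h (e (.inl i)))) :
    famBetti ψ (fun i => h (e (.inl i))) ≤ famBetti ψ h := by
  have h1 := dimAt_ker_eq_add e ψ h
  have h2 := dimAt_famCycles_eq_add e ψ h
  have h3 : dimAt (stdVec ψ) (famBoundary ψ fun i => h (e (.inl i))).ker ≤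
      dimAt (stdVec (ι := κ) ψ) ((famBoundary ψ h).ker ⊓ (projInr ψ e).ker) := by
    refine dimAt_le_of_extendInl e _ _ fun x hx => ?_
    refine Submodule.le_topologicalClosure _ ⟨?_, ?_⟩
    · have hx1 : famBoundary ψ (fun i => h (e (.inl i))) x = 0 := hx
      change famBoundary ψ h _ = 0
      rw [famBoundary_apply] at hx1
      rw [famBoundary_apply, sum_eq_add_of_equiv e]
      simpa using hx1
    · change projInr ψ e _ = 0
      refine ext_of_equiv e (fun j => ?_) (fun s => ?_) <;> simp
  have h4 := dimAt_map_projInr_le e (famCycles ψ h).topologicalClosure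
  have h5 : dimAt (stdVec (ι := κ) ψ) ((famCycles ψ h).topologicalClosure ⊓ (projInr ψ e).ker) ≤
      dimAt (stdVec ψ) (famCycles ψ fun i => h (e (.inl i))) := by
    choose c hc using hw
    refine dimAt_le_of_restrictInl e _ _ inf_le_right fun x hx => ?_
    -- A limit of cycles may vanish on the second block although the approximating cycles do not, so
    -- restricting them need not give cycles. `Φ` rewrites the second block in terms of the first:
    -- it is continuous, maps all finite cycles to finite cycles, and agrees with restriction at x.
    set Φ : Pow ψ κ →L[ℂ] Pow ψ ι := restrictInl ψ e +
      ∑ s, rowMap ψ (c s) ∘L PiLp.proj (𝕜 := ℂ) 2 (fun _ : κ => Ell ψ) (e (.inr s)) with hΦ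
    have hΦa (y : Pow ψ κ) : Φ y = restrictInl ψ e y + ∑ s, rowMap ψ (c s) (y (e (.inr s))) := by
      simp [hΦ]
    have hΦx : Φ x = restrictInl ψ e x := by
      rw [hΦa]
      simp only [apply_inr_of_mem_ker e hx.2, map_zero, Finset.sum_const_zero, add_zero]
    rw [← hΦx]
    have hle : (famCycles ψ h).topologicalClosure ≤
        (famCycles ψ fun i => h (e (.inl i))).topologicalClosure.comap
          (Φ : Pow ψ κ →ₗ[ℂ] Pow ψ ι) := by
      refine Submodule.topologicalClosure_minimal _ ?_
        ((Submodule.isClosed_topologicalClosure _).preimage Φ.continuous)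
      rintro _ ⟨z, hz, rfl⟩
      have h7 : Φ (toPow ψ κ z) = toPow ψ ι ((fun i => z (e (.inl i))) +
          ∑ s, fun i => z (e (.inr s)) * c s i) := by
        rw [hΦa, map_add, map_sum]
        simp only [toPow_apply, rowMap_toEll]
        rfl
      change Φ (toPow ψ κ z) ∈ (famCycles ψ fun i => h (e (.inl i))).topologicalClosure
      rw [h7]
      refine Submodule.le_topologicalClosure _ (toPow_mem_famCycles ψ _ _ ?_)
      have hz' : famAlgBoundary h z = 0 := hz
      rw [map_add, map_sum]
      simp only [famAlgBoundary_smul, hc]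
      rw [famAlgBoundary_apply, sum_eq_add_of_equiv e] at hz'
      rw [famAlgBoundary_apply, hz']
    exact hle hx.1
  have h6 := le_dimAt_map_projInr e (famBoundary ψ h).ker 0 fun s => by
    obtain ⟨z, hz, hzs, hzt⟩ := exists_cycle e h s 1 (by rw [one_mul]; exact hw s)
    refine ⟨toPow ψ κ z, famCycles_le_ker ψ h (toPow_mem_famCycles ψ h z hz),
      fun t ht => ?_, ?_⟩
    · rw [toPow_apply, hzt t ht, map_zero]
    · rw [toPow_apply, hzs, toEll_one, sub_self, norm_zero]
      simp
  unfold famBetti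
  linarith

end Extend

/-! ### Betti numbers of finitely generated groups -/

section Finite

variable {G : Type u} [Group G] {ι : Type*} [Fintype ι]

theorem mul_mem_range_famAlgBoundary (g : ι → G) (w : MonoidAlgebra ℂ G) {x : MonoidAlgebra ℂ G}
    (hx : x ∈ LinearMap.range (famAlgBoundary g)) :
    w * x ∈ LinearMap.range (famAlgBoundary g) := by
  obtain ⟨z, rfl⟩ := hx
  exact ⟨_, famAlgBoundary_smul g w z⟩

/-- The range is a left ideal, so the k with k - 1 in it form a subgroup: xy - 1 = x(y - 1) + (x -
1) and x⁻¹ - 1 = -x⁻¹(x - 1). -/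
theorem of_sub_one_mem_range_famAlgBoundary (g : ι → G) {k : G}
    (hk : k ∈ Subgroup.closure (Set.range g)) :
    MonoidAlgebra.of ℂ G k - 1 ∈ LinearMap.range (famAlgBoundary g) := by
  classical
  induction hk using Subgroup.closure_induction with
  | mem x hx =>
    obtain ⟨i, rfl⟩ := hx
    refine ⟨Pi.single i 1, ?_⟩
    rw [famAlgBoundary_apply, Finset.sum_eq_single i]
    · simp
    · intro j _ hj
      simp [hj]
    · simp
  | one =>
    rw [map_one, sub_self]
    exact Submodule.zero_mem _
  | mul x y _ _ hx hy =>
    have h : MonoidAlgebra.of ℂ G (x * y) - 1 =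
        MonoidAlgebra.of ℂ G x * (MonoidAlgebra.of ℂ G y - 1) + (MonoidAlgebra.of ℂ G x - 1) := by
      rw [map_mul, mul_sub, mul_one, sub_add_sub_cancel]
    rw [h]
    exact Submodule.add_mem _ (mul_mem_range_famAlgBoundary g _ hy) hx
  | inv x _ hx =>
    have h : MonoidAlgebra.of ℂ G x⁻¹ - 1 =
        -(MonoidAlgebra.of ℂ G x⁻¹ * (MonoidAlgebra.of ℂ G x - 1)) := by
      rw [mul_sub, mul_one, ← map_mul, inv_mul_cancel, map_one, neg_sub]
    rw [h]
    exact Submodule.neg_mem _ (mul_mem_range_famAlgBoundary g _ hx)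

theorem exists_bettiOne_eq_famBetti (ψ : GroupCharacter G) (hG : Group.FG G) :
    ∃ S : Finset G, Subgroup.closure (Set.range fun s : S => (s : G)) = ⊤ ∧
      bettiOne ψ hG = famBetti ψ fun s : S => (s : G) := by
  refine ⟨Classical.choose hG.out, ?_, vnDim_reducedHomologyOne _ _⟩
  rw [Subtype.range_coe_subtype]
  exact Classical.choose_spec hG.out

/-- The vectors are orthonormal, so their sum has squared norm |F|. -/
theorem norm_average_delta_sq (ψ : GroupCharacter G) (F : Finset G) (hF : 0 < F.card)
    (h : ∀ r ∈ F, ∀ r' ∈ F, r ≠ r' → ψ (r⁻¹ * r') = 0) :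
    ‖(F.card : ℂ)⁻¹ • ∑ r ∈ F, delta ψ r‖ ^ 2 = 1 / F.card := by
  have h1 : ‖∑ r ∈ F, delta ψ r‖ ^ 2 = F.card := by
    have h2 : inner ℂ (∑ r ∈ F, delta ψ r) (∑ r ∈ F, delta ψ r) = (F.card : ℂ) := by
      rw [sum_inner]
      simp only [inner_sum, inner_delta]
      rw [Finset.card_eq_sum_ones, Nat.cast_sum]
      refine Finset.sum_congr rfl fun r hr => ?_
      rw [Finset.sum_eq_single r]
      · rw [inv_mul_cancel, ψ.map_one, Nat.cast_one]
      · exact fun r' hr' hne => h r hr r' hr' hne.symm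
      · exact fun hn => absurd hr hn
    rw [← inner_self_eq_norm_sq (𝕜 := ℂ), h2]
    simp
  have h3 : (F.card : ℝ) ≠ 0 := by positivity
  rw [norm_smul, mul_pow, h1, norm_inv, Complex.norm_natCast]
  field_simp

/-- Adjoining elements that almost normalize the image of a group does not increase the Betti
number by much. -/
theorem bettiOne_le_add {K : Type*} [Group K] (φ : GroupCharacter K) (ψ : GroupCharacter G)
    (hK : Group.FG K) (hG : Group.FG G) (f : K →* G) (hf : ∀ k, ψ (f k) = φ k)
    {σ : Type*} [Fintype σ] (a : σ → G) (n : ℕ) (hn : 0 < n)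
    (hgen : Subgroup.closure ((f.range : Set G) ∪ Set.range a) = ⊤)
    (hF : ∀ s, ∃ F : Finset G, F.card = n ∧
      (∀ r ∈ F, r ∈ f.range ∧ (a s)⁻¹ * r * a s ∈ f.range) ∧
      ∀ r ∈ F, ∀ r' ∈ F, r ≠ r' → ψ (r⁻¹ * r') = 0) :
    bettiOne ψ hG ≤ bettiOne φ hK + Fintype.card σ * (1 / n) := by
  obtain ⟨SK, hK', hKb⟩ := exists_bettiOne_eq_famBetti φ hK
  obtain ⟨SG, hG', hGb⟩ := exists_bettiOne_eq_famBetti ψ hG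
  rw [hKb, hGb]
  set gK := fun s : SK => (s : K)
  set gG := fun s : SG => (s : G)
  have hfr : f.range = Subgroup.closure (Set.range fun i => f (gK i)) := by
    rw [MonoidHom.range_eq_map, ← hK', MonoidHom.map_closure, ← Set.range_comp]
    rfl
  have hT : Subgroup.closure (Set.range (Sum.elim (fun i => f (gK i)) a)) = ⊤ := by
    rw [Set.Sum.elim_range, Subgroup.closure_union, ← hfr, ← Subgroup.closure_eq f.range,
      ← Subgroup.closure_union, hgen]
  -- The chosen generators of G are exchanged for the images of those of K together with a: adjoin
  -- the latter (`h1`), then drop the former at no cost (`h2`). Dropping a costs |σ|/n (`h3`).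
  have h1 := famBetti_inl_le ψ (Equiv.refl _) (Sum.elim gG (Sum.elim (fun i => f (gK i)) a))
    fun s => of_sub_one_mem_range_famAlgBoundary gG (by rw [hG']; trivial)
  have h2 := famBetti_le_add ψ (Equiv.sumComm _ _)
    (Sum.elim gG (Sum.elim (fun i => f (gK i)) a)) 0 fun s => by
      refine ⟨1, ?_, ?_⟩
      · rw [one_mul]
        exact of_sub_one_mem_range_famAlgBoundary (Sum.elim (fun i => f (gK i)) a)
          (by rw [hT]; trivial)
      · rw [toEll_one, sub_self, norm_zero]
        simp
  have h3 := famBetti_le_add ψ (Equiv.refl _) (Sum.elim (fun i => f (gK i)) a) (1 / n) fun s => by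
    obtain ⟨F, hFn, hFr, hFψ⟩ := hF s
    have hn' : (F.card : ℂ) ≠ 0 := by
      rw [hFn]
      exact_mod_cast hn.ne'
    -- The average of `F` has squared norm 1/n, so this element is close to 1. It is also an average
    -- of elements 1 - r, and (1 - r)(a - 1) = (r - 1) - a(a⁻¹ra - 1) lies in the left ideal of
    -- boundaries.
    refine ⟨1 - (F.card : ℂ)⁻¹ • ∑ r ∈ F, MonoidAlgebra.of ℂ G r, ?_, ?_⟩
    · have e1 : (1 : MonoidAlgebra ℂ G) - (F.card : ℂ)⁻¹ • ∑ r ∈ F, MonoidAlgebra.of ℂ G r =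
          (F.card : ℂ)⁻¹ • ∑ r ∈ F, (1 - MonoidAlgebra.of ℂ G r) := by
        rw [Finset.sum_sub_distrib, smul_sub, Finset.sum_const, ← Nat.cast_smul_eq_nsmul ℂ,
          smul_smul, inv_mul_cancel₀ hn', one_smul]
      rw [e1, smul_mul_assoc, Finset.sum_mul]
      refine Submodule.smul_mem _ _ (Submodule.sum_mem _ fun r hr => ?_)
      have e2 : (1 - MonoidAlgebra.of ℂ G r) * (MonoidAlgebra.of ℂ G (a s) - 1) =
          (MonoidAlgebra.of ℂ G r - 1) -
            MonoidAlgebra.of ℂ G (a s) * (MonoidAlgebra.of ℂ G ((a s)⁻¹ * r * a s) - 1) := by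
        rw [mul_sub (MonoidAlgebra.of ℂ G (a s)), ← map_mul, mul_sub, sub_mul, ← map_mul]
        rw [show a s * ((a s)⁻¹ * r * a s) = r * a s by group]
        simp only [one_mul, mul_one]
        abel
      change (1 - MonoidAlgebra.of ℂ G r) * (MonoidAlgebra.of ℂ G (a s) - 1) ∈ _
      rw [e2]
      obtain ⟨hr1, hr2⟩ := hFr r hr
      rw [hfr] at hr1 hr2
      exact Submodule.sub_mem _ (of_sub_one_mem_range_famAlgBoundary _ hr1)
        (mul_mem_range_famAlgBoundary _ _ (of_sub_one_mem_range_famAlgBoundary _ hr2))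
    · rw [map_sub, toEll_one, sub_sub_cancel, map_smul, map_sum]
      simp only [toEll_of]
      rw [norm_average_delta_sq ψ F (by rwa [hFn]) hFψ, hFn]
  have h4 := famBetti_comp_le φ ψ f hf gK
  simp only [Equiv.refl_apply, Sum.elim_inl, Equiv.sumComm_apply, Sum.swap_inl, Sum.elim_inr,
    mul_zero, add_zero] at h1 h2 h3
  calc famBetti ψ gG ≤ _ := h1
    _ ≤ _ := h2
    _ ≤ _ := h3
    _ ≤ _ := by gcongr

end Finite

/-! ### Bounds for Betti numbers of arbitrary groups -/

section Bar

variable {G : Type u} [Group G] (ψ : GroupCharacter G)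

/-- The first Betti number of a finitely generated subgroup. -/
def subBetti (K : Subgroup G) (hK : K.FG) : ℝ :=
  bettiOne (ψ.restrict K) ((Group.fg_iff_subgroup_fg K).2 hK)

/-- Finitely generated subgroups are directed under joins, so the liminf is the supremum over K₀ of
the infimum over K ≥ K₀. Real m suffice as they are dense in the extended reals. -/
theorem bettiOneBar_le_iff (c : EReal) :
    bettiOneBar ψ ≤ c ↔ ∀ K₀ : Subgroup G, K₀.FG → ∀ m : ℝ, c < m →
      ∃ (K : Subgroup G) (hK : K.FG), K₀ ≤ K ∧ subBetti ψ K hK < m := by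
  have : IsDirectedOrder {K : Subgroup G // K.FG} :=
    ⟨fun K L => ⟨⟨K.1 ⊔ L.1, K.2.sup L.2⟩, le_sup_left (a := K.1), le_sup_right (a := K.1)⟩⟩
  have : Nonempty {K : Subgroup G // K.FG} := ⟨⟨⊥, .bot⟩⟩
  rw [bettiOneBar, Filter.atTop_basis.liminf_eq_iSup_iInf]
  simp only [iSup_pos, iSup_le_iff, Subtype.forall]
  refine forall₂_congr fun K₀ hK₀ => ⟨fun h m hm => ?_, fun h => ?_⟩
  · obtain ⟨K, hK⟩ := iInf_lt_iff.1 (h.trans_lt hm)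
    obtain ⟨hle, hK⟩ := iInf_lt_iff.1 hK
    exact ⟨K.1, K.2, hle, EReal.coe_lt_coe_iff.1 hK⟩
  · refine le_of_forall_gt fun d hd => ?_
    obtain ⟨m, hm, hmd⟩ := EReal.lt_iff_exists_real_btwn.1 hd
    obtain ⟨K, hK, hle, hKm⟩ := h m hm
    refine lt_of_le_of_lt (iInf₂_le (⟨K, hK⟩ : {K : Subgroup G // K.FG}) hle) ?_
    exact (EReal.coe_lt_coe_iff.2 hKm).trans hmd

/-- The finitely generated subgroups of `H` are contained in finitely generated subgroups of `H`
of Betti number at most `c`, up to arbitrarily small errors. -/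
def BettiBound (H : Subgroup G) (c : EReal) : Prop :=
  ∀ K₀ : Subgroup G, K₀.FG → K₀ ≤ H → ∀ m : ℝ, c < m →
    ∃ (K : Subgroup G) (hK : K.FG), K₀ ≤ K ∧ K ≤ H ∧ subBetti ψ K hK < m

variable {ψ}

theorem bettiOneBar_le_of_bettiBound {c : EReal} (h : BettiBound ψ ⊤ c) : bettiOneBar ψ ≤ c :=
  (bettiOneBar_le_iff ψ c).2 fun K₀ hK₀ m hm => by
    obtain ⟨K, hK, hle, -, hKm⟩ := h K₀ hK₀ le_top m hm
    exact ⟨K, hK, hle, hKm⟩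

/-- The two groups are isomorphic, but their Betti numbers are computed from unrelated generating
sets; `bettiOne_le_add` with nothing adjoined compares them. -/
theorem subBetti_map_le (H : Subgroup G) (K : Subgroup H) (hK : K.FG)
    (hK' : (K.map H.subtype).FG) :
    subBetti ψ (K.map H.subtype) hK' ≤ subBetti (ψ.restrict H) K hK := by
  have h := bettiOne_le_add ((ψ.restrict H).restrict K) (ψ.restrict (K.map H.subtype))
    ((Group.fg_iff_subgroup_fg K).2 hK) ((Group.fg_iff_subgroup_fg _).2 hK')
    (K.equivMapOfInjective H.subtype H.subtype_injective).toMonoidHom (fun k => rfl)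
    (σ := Empty) Empty.elim 1 one_pos
    (by
      rw [MonoidHom.range_eq_top.2 (MulEquiv.surjective _)]
      simp)
    (fun s => s.elim)
  simpa [subBetti] using h

theorem bettiBound_bettiOneBar (H : Subgroup G) :
    BettiBound ψ H (bettiOneBar (ψ.restrict H)) := fun K₀ hK₀ hle m hm => by
  have h0 : (K₀.subgroupOf H).FG := by
    rw [← Group.fg_iff_subgroup_fg] at hK₀ ⊢
    exact Group.fg_of_surjective (f := (Subgroup.subgroupOfEquivOfLe hle).symm.toMonoidHom)
      (MulEquiv.surjective _)
  obtain ⟨K, hK, hKle, hKm⟩ := (bettiOneBar_le_iff (ψ.restrict H) _).1 le_rfl _ h0 m hm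
  have hK' : (K.map H.subtype).FG := by
    rw [Subgroup.fg_iff_submonoid_fg] at hK ⊢
    exact hK.map H.subtype
  refine ⟨K.map H.subtype, hK', ?_, Subgroup.map_subtype_le K,
    (subBetti_map_le H K hK hK').trans_lt hKm⟩
  have h1 := Subgroup.map_mono (f := H.subtype) hKle
  rwa [Subgroup.map_subgroupOf_eq_of_le hle] at h1

/-- A finite generating set contained in the union of a chain lies in one of its members. -/
theorem BettiBound.iSup {ι : Type*} [Nonempty ι] [LinearOrder ι] {C : ι → Subgroup G}
    (hC : Monotone C) {c : EReal} (h : ∀ i, BettiBound ψ (C i) c) : BettiBound ψ (⨆ i, C i) c := by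
  intro K₀ hK₀ hle m hm
  obtain ⟨S, rfl⟩ := hK₀
  have hS : ∃ i, (S : Set G) ⊆ C i := by
    have h1 : (S : Set G) ⊆ ⋃ i, (C i : Set G) := by
      rw [← Subgroup.coe_iSup_of_directed hC.directed_le]
      exact (Subgroup.closure_le _).1 hle
    have h2 : Monotone fun i => (C i : Set G) := fun i j hij => hC hij
    exact h2.directed_le.exists_mem_subset_of_finset_subset_biUnion h1
  obtain ⟨i, hi⟩ := hS
  obtain ⟨K, hK, hK0, hKi, hKm⟩ := h i _ ⟨S, rfl⟩ ((Subgroup.closure_le _).2 hi) m hm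
  exact ⟨K, hK, hK0, hKi.trans (le_iSup C i), hKm⟩

theorem exists_finset_mem_closure {s : Set G} {x : G} (hx : x ∈ Subgroup.closure s) :
    ∃ t : Finset G, (t : Set G) ⊆ s ∧ x ∈ Subgroup.closure (t : Set G) := by
  classical
  induction hx using Subgroup.closure_induction with
  | mem x hx => exact ⟨{x}, by simpa using hx, Subgroup.subset_closure (by simp)⟩
  | one => exact ⟨∅, by simp, Subgroup.one_mem _⟩
  | mul x y _ _ hx hy =>
    obtain ⟨t, ht, hxt⟩ := hx
    obtain ⟨t', ht', hyt⟩ := hy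
    refine ⟨t ∪ t', by simp [ht, ht'], Subgroup.mul_mem _ ?_ ?_⟩
    · exact Subgroup.closure_mono (by simp) hxt
    · exact Subgroup.closure_mono (by simp) hyt
  | inv x _ hx =>
    obtain ⟨t, ht, hxt⟩ := hx
    exact ⟨t, ht, Subgroup.inv_mem _ hxt⟩

theorem exists_finset_le_closure {s : Set G} {K : Subgroup G} (hK : K.FG)
    (hle : K ≤ Subgroup.closure s) :
    ∃ t : Finset G, (t : Set G) ⊆ s ∧ K ≤ Subgroup.closure (t : Set G) := by
  classical
  obtain ⟨S, rfl⟩ := hK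
  choose! t ht hxt using fun x (hx : x ∈ S) =>
    exists_finset_mem_closure (hle (Subgroup.subset_closure hx))
  refine ⟨S.biUnion t, by simpa using ht, (Subgroup.closure_le _).2 fun x hx => ?_⟩
  refine Subgroup.closure_mono ?_ (hxt x hx)
  exact_mod_cast Finset.subset_biUnion_of_mem t hx

/-- Only finitely many elements of A are needed to generate a group containing K₀. The bound for H
yields K ≤ H containing enough elements and conjugates for each of them, and adjoining them to K
costs little by `bettiOne_le_add`. -/
theorem BettiBound.of_isQNormalIn {H L : Subgroup G} (hHL : IsQNormalIn ψ H L) {c : EReal}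
    (h : BettiBound ψ H c) : BettiBound ψ L c := by
  classical
  obtain ⟨A, rfl, hA⟩ := hHL
  intro K₀ hK₀ hle m hm
  obtain ⟨m', hm', hmm⟩ := EReal.lt_iff_exists_real_btwn.1 hm
  have hmm' : m' < m := EReal.coe_lt_coe_iff.1 hmm
  obtain ⟨t, ht, hKt⟩ := exists_finset_le_closure hK₀ hle
  set tH := t.filter (· ∈ H)
  set tA := t.filter (· ∈ A)
  -- With this n the total error |tA|/n stays below the slack m - m'.
  obtain ⟨n, hn⟩ := exists_nat_gt ((tA.card : ℝ) / (m - m'))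
  have hn0 : (0 : ℝ) < n := lt_of_le_of_lt (div_nonneg (by positivity) (by linarith)) hn
  have hF : ∀ a ∈ tA, ∃ F : Finset G, F.card = n ∧ (∀ r ∈ F, r ∈ H ∧ a⁻¹ * r * a ∈ H) ∧
      ∀ r ∈ F, ∀ r' ∈ F, r ≠ r' → ψ (r⁻¹ * r') = 0 := fun a ha => by
    -- Any n elements of the infinite regular subgroup do: for r ≠ r' the quotient r⁻¹r' is a
    -- nontrivial element of `R`.
    obtain ⟨R, hR, hinf, hreg⟩ := hA a (Finset.mem_filter.1 ha).2
    obtain ⟨F, hF⟩ := Infinite.exists_subset_card_eq R n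
    have hmem : ∀ r ∈ F.map (Function.Embedding.subtype _), r ∈ R := fun r hr => by
      obtain ⟨r, -, rfl⟩ := Finset.mem_map.1 hr
      exact r.2
    refine ⟨F.map (Function.Embedding.subtype _), by rw [Finset.card_map, hF], fun r hr => ?_,
      fun r hr r' hr' hne => ?_⟩
    · obtain ⟨h1, k, hk, hkr⟩ := hR (hmem r hr)
      refine ⟨h1, ?_⟩
      rw [← hkr]
      simpa [mul_assoc] using hk
    · refine hreg _ (R.mul_mem (R.inv_mem (hmem r hr)) (hmem r' hr')) fun h1 => hne ?_
      exact inv_mul_eq_one.1 h1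
  choose! F hFn hFH hFψ using hF
  -- K must contain the part of t in H, and also both `F a` and its conjugates.
  set X : Finset G := tH ∪ tA.biUnion fun a => F a ∪ (F a).image fun r => a⁻¹ * r * a with hX
  have hXH : (X : Set G) ⊆ H := fun x hx => by
    rcases Finset.mem_union.1 (Finset.mem_coe.1 hx) with hx | hx
    · exact (Finset.mem_filter.1 hx).2
    · obtain ⟨a, ha, hx⟩ := Finset.mem_biUnion.1 hx
      rcases Finset.mem_union.1 hx with hx | hx
      · exact (hFH a ha x hx).1
      · obtain ⟨r, hr, rfl⟩ := Finset.mem_image.1 hx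
        exact (hFH a ha r hr).2
  obtain ⟨K, hK, hXK, hKH, hKm⟩ := h (Subgroup.closure X) ⟨X, rfl⟩
    ((Subgroup.closure_le _).2 hXH) m' hm'
  rw [Subgroup.closure_le] at hXK
  set M := K ⊔ Subgroup.closure (tA : Set G) with hM
  have hMfg : M.FG := hK.sup ⟨tA, rfl⟩
  have hKM : K ≤ M := le_sup_left
  have hAM : ∀ a ∈ tA, a ∈ M := fun a ha =>
    (le_sup_right : _ ≤ M) (Subgroup.subset_closure (Finset.mem_coe.2 ha))
  refine ⟨M, hMfg, ?_, ?_, ?_⟩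
  · refine hKt.trans ((Subgroup.closure_le _).2 fun x hx => ?_)
    rcases ht hx with hxH | hxA
    · exact hKM (hXK (Finset.mem_coe.2 (Finset.mem_union_left _ (Finset.mem_filter.2 ⟨hx, hxH⟩))))
    · exact hAM x (Finset.mem_filter.2 ⟨hx, hxA⟩)
  · refine sup_le (hKH.trans ?_) (Subgroup.closure_mono fun x hx => ?_)
    · exact fun x hx => Subgroup.subset_closure (Or.inl hx)
    · exact Or.inr (Finset.mem_filter.1 (Finset.mem_coe.1 hx)).2
  · have hrange : ∀ x, ∀ hx : x ∈ K, (⟨x, hKM hx⟩ : M) ∈ (Subgroup.inclusion hKM).range :=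
      fun x hx => ⟨⟨x, hx⟩, rfl⟩
    have h1 := bettiOne_le_add (ψ.restrict K) (ψ.restrict M)
      ((Group.fg_iff_subgroup_fg K).2 hK) ((Group.fg_iff_subgroup_fg M).2 hMfg)
      (Subgroup.inclusion hKM) (fun k => rfl) (σ := tA) (fun a => ⟨a, hAM a a.2⟩) n
      (by exact_mod_cast hn0) ?_ ?_
    · have h2 : (tA.card : ℝ) * (1 / n) < m - m' := by
        rw [div_lt_iff₀ (by linarith)] at hn
        rw [mul_one_div, div_lt_iff₀ hn0, mul_comm]
        exact hn
      rw [Fintype.card_coe] at h1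
      change subBetti ψ M hMfg ≤ subBetti ψ K hK + _ at h1
      linarith
    -- Generation of `M` is checked after mapping into G, where it is the definition of `M` as a
    -- join.
    · refine Subgroup.map_injective M.subtype_injective ?_
      rw [MonoidHom.map_closure, Set.image_union, ← MonoidHom.range_eq_map, Subgroup.range_subtype,
        ← Set.range_comp, Subgroup.closure_union]
      refine (congrArg₂ (· ⊔ ·) ?_ (congrArg _ ?_)).trans hM.symm
      · rw [← Subgroup.coe_map, Subgroup.closure_eq, ← MonoidHom.range_comp,
          Subgroup.subtype_comp_inclusion, Subgroup.range_subtype]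
      · ext x
        simp
    · intro s
      have hs := s.2
      have hFM : ∀ r ∈ F s, r ∈ K ∧ (s : G)⁻¹ * r * s ∈ K := fun r hr => by
        constructor <;> refine hXK (Finset.mem_coe.2 (Finset.mem_union_right _
          (Finset.mem_biUnion.2 ⟨s, hs, ?_⟩)))
        · exact Finset.mem_union_left _ hr
        · exact Finset.mem_union_right _ (Finset.mem_image_of_mem _ hr)
      refine ⟨(F s).subtype (· ∈ M), ?_, fun r hr => ?_, fun r hr r' hr' hne => ?_⟩
      · rw [Finset.card_subtype, Finset.filter_true_of_mem fun r hr => hKM (hFM r hr).1, hFn s hs]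
      · have := hFM r (Finset.mem_subtype.1 hr)
        exact ⟨hrange _ this.1, hrange _ this.2⟩
      · exact hFψ s hs r (Finset.mem_subtype.1 hr) r' (Finset.mem_subtype.1 hr')
          fun h => hne (Subtype.ext h)

theorem bettiOneBar_le_of_isWeaklyQNormal {H : Subgroup G} (hH : IsWeaklyQNormal.{u, v} ψ H) :
    bettiOneBar ψ ≤ bettiOneBar (ψ.restrict H) := by
  obtain ⟨α, C, h0, hα, hmono, hC⟩ := hH
  have key : ∀ γ ≤ α, BettiBound ψ (C γ) (bettiOneBar (ψ.restrict H)) := fun γ => by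
    induction γ using WellFoundedLT.induction with
    | _ γ ih =>
      intro hγ
      -- Only γ = 0 is special: successor and limit stages are treated alike, through the union of
      -- all earlier members of the chain.
      rcases eq_or_ne γ 0 with rfl | hne
      · rw [h0]
        exact bettiBound_bettiOneBar H
      · have hpos : 0 < γ := pos_iff_ne_zero.2 hne
        have : Nonempty (Set.Iio γ) := ⟨⟨0, hpos⟩⟩
        refine BettiBound.of_isQNormalIn (hC γ hpos hγ) (BettiBound.iSup ?_ ?_)
        · exact fun β β' hle => hmono _ _ hle (β'.2.le.trans hγ)
        · exact fun β => ih β β.2 (β.2.le.trans hγ)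
  exact bettiOneBar_le_of_bettiBound (hα ▸ key α le_rfl)

end Bar

end PsiBetti

end

theorem mainTheorem4 {G : Type u} [Group G] (ψ : PsiBetti.GroupCharacter G) (H : Subgroup G)
    (hH : PsiBetti.IsWeaklyQNormal.{u, v} ψ H) :
    PsiBetti.bettiOneBar ψ ≤ PsiBetti.bettiOneBar (ψ.restrict H) :=
  PsiBetti.bettiOneBar_le_of_isWeaklyQNormal hH
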